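/- **Setting.** Let $F$ be a field. A tensor over finite sets of variables $X,Y,Z$ is a trilinear form $T=\sum_{x,y,z} a_{xyz}\,x\,y\,z$ with $a_{xyz}\in F$. Its rotation $T^r$ is the tensor over $Y,Z,X$ whose coefficient of $y\,z\,x$ is $a_{xyz}$, and $T^{rr}=(T^r)^r$; $\otimes$ is the Kronecker product. $T'$ (over $X',Y',Z'$) is a restriction of $T$ if $T'=\sum a_{xyz}\,A(x)B(y)C(z)$ for some linear maps $A:\mathrm{span}_F X\to \mathrm{span}_F X'$, $B:\mathrm{span}_F Y\to \mathrm{span}_F Y'$, $C:\mathrm{span}_F Z\to \mathrm{span}_F Z'$. Write $\langle a,b,c\rangle=\sum_{i\in[a],j\in[b],k\in[c]}x_{ij}y_{jk}z_{ki}$ for positive integers $a,b,c$. For $\tau\in[2/3,1]$ the value $V_\tau(T)$ is the supremum of $\bigl(\sum_{i=1}^m(a_ib_ic_i)^\tau\bigr)^{1/(3n)}$ over all positive integers $n$ and all direct sums $\bigoplus_{i=1}^m\langle a_i,b_i,c_i\rangle$ that are restrictions of $(T\otimes T^r\otimes T^{rr})^{\otimes n}$ (the supremum is $0$ if $T=0$).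 Let $T$ be a tensor over $X,Y,Z$ with partitions $X=X_1\cup\dots\cup X_{k_X}$, $Y=Y_1\cup\dots\cup Y_{k_Y}$, $Z=Z_1\cup\dots\cup Z_{k_Z}$ into disjoint (possibly empty) parts, let $T_{ijk}$ be $T$ restricted to the variables in $X_i,Y_j,Z_k$, and let $S=\{(i,j,k): T_{ijk}\neq0\}$. $T$ is $P$-partitioned, for an integer $P$, if $i+j+k=P$ for all $(i,j,k)\in S$. Let $D$ be the set of all $\alpha:S\to[0,1]$ with $\sum_{(i,j,k)\in S}\alpha_{ijk}=1$. For $\alpha\in D$ let $\alpha_{X_i}=\sum_{j,k:(i,j,k)\in S}\alpha_{ijk}$, and define $\alpha_{Y_j}$, $\alpha_{Z_k}$ similarly. With $0^0=1$, put $$\alpha_B=\Bigl(\prod_{i}\alpha_{X_i}^{-\alpha_{X_i}}\Bigr)^{1/3}\Bigl(\prod_{j}\alpha_{Y_j}^{-\alpha_{Y_j}}\Bigr)^{1/3}\Bigl(\prod_{k}\alpha_{Z_k}^{-\alpha_{Z_k}}\Bigr)^{1/3},\quad \alpha_N=\prod_{(i,j,k)\in S}\alpha_{ijk}^{-\alpha_{ijk}},\quad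 \alpha_{V_\tau}=\prod_{(i,j,k)\in S}V_\tau(T_{ijk})^{\alpha_{ijk}},$$ and let $D_\alpha$ be the set of $\beta\in D$ with $\beta_{X_i}=\alpha_{X_i}$, $\beta_{Y_j}=\alpha_{Y_j}$, $\beta_{Z_k}=\alpha_{Z_k}$ for all $i,j,k$. **Theorem (Refined Laser Method).** For every $P$-partitioned tensor $T$, every $\alpha\in D$ and every $\tau\in[2/3,1]$, the maximum $\max_{\beta\in D_\alpha}\beta_N$ exists and $$V_\tau(T)\;\ge\;\alpha_{V_\tau}\cdot\alpha_B\cdot\sqrt{\frac{\alpha_N}{\max_{\beta\in D_\alpha}\beta_N}}.$$ -/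

import Mathlib

namespace RefinedLaser

/-! ### Tensors over finite variable sets -/

/-- A tensor over variable sets `X`, `Y`, `Z`, given by its coefficients: the trilinear form
`∑ x, ∑ y, ∑ z, T x y z · x y z`. -/
abbrev Tensor (F X Y Z : Type*) := X → Y → Z → F

/-- The rotation `T^r`, a tensor over `Y, Z, X`. -/
def Tensor.rot {F X Y Z : Type*} (T : Tensor F X Y Z) : Tensor F Y Z X :=
  fun y z x => T x y z

/-- The Kronecker product of two tensors. -/
def Tensor.kron {F X Y Z X' Y' Z' : Type*} [Mul F] (T : Tensor F X Y Z) (T' : Tensor F X' Y' Z') :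
    Tensor F (X × X') (Y × Y') (Z × Z') :=
  fun x y z => T x.1 y.1 z.1 * T' x.2 y.2 z.2

/-- The Kronecker power `T^{⊗ n}`, a tensor over `X^n, Y^n, Z^n`. -/
def Tensor.kronPow {F X Y Z : Type*} [CommMonoid F] (T : Tensor F X Y Z) (n : ℕ) :
    Tensor F (Fin n → X) (Fin n → Y) (Fin n → Z) :=
  fun x y z => ∏ l, T (x l) (y l) (z l)

/-- The direct sum of a family of tensors, over the disjoint unions of the variable sets: the
coefficient of a triple of variables is that of the `i`-th tensor if all three variables belong to
the `i`-th tensor, and `0` if they do not all belong to the same tensor. -/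
def directSum {F ι : Type*} [Zero F] [DecidableEq ι] {X Y Z : ι → Type*}
    (T : ∀ i, Tensor F (X i) (Y i) (Z i)) : Tensor F (Σ i, X i) (Σ i, Y i) (Σ i, Z i) :=
  fun x y z =>
    if h : y.1 = x.1 ∧ z.1 = x.1 then T x.1 x.2 (h.1 ▸ y.2) (h.2 ▸ z.2) else 0

theorem directSum_same {F ι : Type*} [Zero F] [DecidableEq ι] {X Y Z : ι → Type*}
    (T : ∀ i, Tensor F (X i) (Y i) (Z i)) (i : ι) (x : X i) (y : Y i) (z : Z i) :
    directSum T ⟨i, x⟩ ⟨i, y⟩ ⟨i, z⟩ = T i x y z := by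
  simp [directSum]

theorem directSum_ne {F ι : Type*} [Zero F] [DecidableEq ι] {X Y Z : ι → Type*}
    (T : ∀ i, Tensor F (X i) (Y i) (Z i)) (x : Σ i, X i) (y : Σ i, Y i) (z : Σ i, Z i)
    (h : ¬ (y.1 = x.1 ∧ z.1 = x.1)) : directSum T x y z = 0 := by
  simp [directSum, h]

/-- The matrix multiplication tensor `⟨a, b, c⟩ = ∑ i j k, x_{ij} y_{jk} z_{ki}`. -/
def matMul (F : Type*) [Zero F] [One F] (a b c : ℕ) :
    Tensor F (Fin a × Fin b) (Fin b × Fin c) (Fin c × Fin a) :=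
  fun x y z => if x.2 = y.1 ∧ y.2 = z.1 ∧ z.2 = x.1 then 1 else 0

/-- `T'.IsRestrictionOf T`: there are linear maps `A : span X → span X'`, `B : span Y → span Y'`,
`C : span Z → span Z'`, given here by their matrices (`A x = ∑ x', A x x' · x'`), with
`T' = ∑ x y z, T x y z · A(x) B(y) C(z)`. -/
def Tensor.IsRestrictionOf {F X Y Z X' Y' Z' : Type*} [Field F] [Fintype X] [Fintype Y] [Fintype Z]
    (T' : Tensor F X' Y' Z') (T : Tensor F X Y Z) : Prop :=
  ∃ (A : Matrix X X' F) (B : Matrix Y Y' F) (C : Matrix Z Z' F), ∀ x' y' z',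
    T' x' y' z' = ∑ x, ∑ y, ∑ z, T x y z * (A x x' * B y y' * C z z')

/-- The `τ`-value of `T`: the supremum of `(∑ i, (a i * b i * c i) ^ τ) ^ (1 / (3 n))` over all
positive `n` and all direct sums `⊕ i, ⟨a i, b i, c i⟩` of matrix multiplication tensors that are
restrictions of `(T ⊗ T^r ⊗ T^{rr})^{⊗ n}`. The supremum is taken in `[0, ∞]`. -/
noncomputable def value {F X Y Z : Type*} [Field F] [Fintype X] [Fintype Y] [Fintype Z]
    (τ : ℝ) (T : Tensor F X Y Z) : ENNReal :=
  sSup {v : ENNReal | ∃ (n m : ℕ) (a b c : Fin m → ℕ), 0 < n ∧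
    (∀ i, 0 < a i ∧ 0 < b i ∧ 0 < c i) ∧
    (directSum fun i => matMul F (a i) (b i) (c i)).IsRestrictionOf
      (((T.kron T.rot).kron T.rot.rot).kronPow n) ∧
    v = ENNReal.ofReal ((∑ i, ((a i * b i * c i : ℕ) : ℝ) ^ τ) ^ (1 / (3 * (n : ℝ))))}

/-! ### Partitioned tensors -/

/-- A tensor with partitions of its three variable sets into `kX`, `kY`, `kZ` parts; `partX x = i`
says that the variable `x` lies in the part `X_i`. -/
structure BlockTensor (F X Y Z : Type*) (kX kY kZ : ℕ) where
  /-- the underlying tensor -/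
  tensor : Tensor F X Y Z
  /-- the partition of the `x`-variables -/
  partX : X → Fin kX
  /-- the partition of the `y`-variables -/
  partY : Y → Fin kY
  /-- the partition of the `z`-variables -/
  partZ : Z → Fin kZ

namespace BlockTensor

variable {F X Y Z : Type*} {kX kY kZ : ℕ}

/-- The block `T_{ijk}`, i.e. the tensor `T` restricted to the variables in `X_i, Y_j, Z_k`. -/
def block (T : BlockTensor F X Y Z kX kY kZ) (i : Fin kX) (j : Fin kY) (k : Fin kZ) :
    Tensor F {x // T.partX x = i} {y // T.partY y = j} {z // T.partZ z = k} :=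
  fun x y z => T.tensor x y z

variable [Field F]

open Classical in
/-- The set `S` of the indices of the nonzero blocks. -/
noncomputable def nonzeroBlocks (T : BlockTensor F X Y Z kX kY kZ) :
    Finset (Fin kX × Fin kY × Fin kZ) :=
  {s | T.block s.1 s.2.1 s.2.2 ≠ 0}

/-- `T` is `P`-partitioned: every nonzero block `T_{ijk}` has `i + j + k = P`. The parts are
numbered from `1`, while `Fin` starts at `0`, hence the shifts. -/
def IsPartitioned (T : BlockTensor F X Y Z kX kY kZ) (P : ℤ) : Prop :=
  ∀ s ∈ T.nonzeroBlocks,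
    ((s.1 : ℕ) + 1 : ℤ) + ((s.2.1 : ℕ) + 1 : ℤ) + ((s.2.2 : ℕ) + 1 : ℤ) = P

/-- The set `D` of probability distributions on the nonzero blocks. A distribution is extended by
`0` to the indices of the zero blocks. -/
def distributions (T : BlockTensor F X Y Z kX kY kZ) :
    Set (Fin kX × Fin kY × Fin kZ → ℝ) :=
  {α | (∀ s, α s ∈ Set.Icc (0 : ℝ) 1) ∧ (∀ s ∉ T.nonzeroBlocks, α s = 0) ∧
    ∑ s ∈ T.nonzeroBlocks, α s = 1}

end BlockTensor

section Distributions

variable {kX kY kZ : ℕ}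

/-- The marginal `α_{X_i}`. -/
def margX (α : Fin kX × Fin kY × Fin kZ → ℝ) (i : Fin kX) : ℝ := ∑ j, ∑ k, α (i, j, k)

/-- The marginal `α_{Y_j}`. -/
def margY (α : Fin kX × Fin kY × Fin kZ → ℝ) (j : Fin kY) : ℝ := ∑ i, ∑ k, α (i, j, k)

/-- The marginal `α_{Z_k}`. -/
def margZ (α : Fin kX × Fin kY × Fin kZ → ℝ) (k : Fin kZ) : ℝ := ∑ i, ∑ j, α (i, j, k)

/-- `α_B`; the real power satisfies `0 ^ 0 = 1`. -/
noncomputable def alphaB (α : Fin kX × Fin kY × Fin kZ → ℝ) : ℝ :=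
  (∏ i, margX α i ^ (-margX α i)) ^ (1 / 3 : ℝ) *
  (∏ j, margY α j ^ (-margY α j)) ^ (1 / 3 : ℝ) *
  (∏ k, margZ α k ^ (-margZ α k)) ^ (1 / 3 : ℝ)

end Distributions

namespace BlockTensor

variable {F X Y Z : Type*} [Field F] {kX kY kZ : ℕ}

/-- The set `D_α` of distributions on the nonzero blocks with the same marginals as `α`. -/
def sameMarginals (T : BlockTensor F X Y Z kX kY kZ) (α : Fin kX × Fin kY × Fin kZ → ℝ) :
    Set (Fin kX × Fin kY × Fin kZ → ℝ) :=
  {β | β ∈ T.distributions ∧ (∀ i, margX α i = margX β i) ∧ (∀ j, margY α j = margY β j) ∧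
    ∀ k, margZ α k = margZ β k}

/-- `α_N`, the product of `α_s ^ (-α_s)` over the nonzero blocks. -/
noncomputable def alphaN (T : BlockTensor F X Y Z kX kY kZ)
    (α : Fin kX × Fin kY × Fin kZ → ℝ) : ℝ :=
  ∏ s ∈ T.nonzeroBlocks, α s ^ (-α s)

/-- `α_{V_τ}`, the product of `V_τ(T_s) ^ α_s` over the nonzero blocks. -/
noncomputable def alphaV [Fintype X] [Fintype Y] [Fintype Z]
    (T : BlockTensor F X Y Z kX kY kZ) (τ : ℝ) (α : Fin kX × Fin kY × Fin kZ → ℝ) : ENNReal :=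
  ∏ s ∈ T.nonzeroBlocks, value τ (T.block s.1 s.2.1 s.2.2) ^ α s

end BlockTensor

end RefinedLaser

/-!
A power of `T ⊗ T^r ⊗ T^rr` is a sum of blocks, indexed by triples `d` of sequences of block indices
of `T` (`BlockTriple`); `d` meets one part of each of the three variable sets, its labels. All three
sequences of a triple are taken from one type class, that of a type `t` close to `n α`. Such a block
is, up to a permutation of its factors, a product of the tensors `T_s ⊗ T_s^r ⊗ T_s^rr`, each
occurring `t s` times, and so it achieves about `∏ V(T_s) ^ (3 n α_s)` (`achieves_of_matching`). It
remains to select many of these blocks and to set variables to zero so that exactly the selected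
blocks survive, as a direct sum: the selected triples must form an induced matching among the label
triples of all nonzero blocks.

Rotating the tensor makes the three label sets equally large, about `α_B ^ (3 n)`. Nonzero blocks
satisfy `i + j + k = P`, so the labels of a block sum to a constant, and two of them determine the
third. A random affine hash modulo a prime `M`, followed by the restriction to labels hashing into a
progression-free set (Behrend), therefore keeps only triples all of whose labels have the same hash
(`Survives.hash_eq`). With `M` a constant times the number of selected-type triples per label, few
triples of type `t` collide with each other (`exists_good_hash`), and about `α_B ^ (3 n)` of them are
isolated. The modulus is too small to remove the triples of the other types in `D_α`. Each of these
uses labels of three *different* isolated triples, because two labels determine the third; they thus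
form the edges of a 3-uniform hypergraph on the isolated triples, with average degree about
`(max β_N / α_N) ^ (3 n)`. Such a hypergraph has an independent set with a fraction
`(α_N / max β_N) ^ (3 n / 2)` of the vertices (`exists_independent_set`), which is the square root
in the bound. The loss in Behrend's theorem is subexponential in `n`.

The counting is done with entropies. Chebyshev's inequality and the pigeonhole principle give one
type `t` near `n α` that carries a polynomial share of the `α`-probability
(`exists_typical_type`); then the number of sequences of type `t` per label is bounded by a quotient
of probabilities (`card_typeClass_fiber_mul_le`), and the number of sequences with the marginals of
`t` by a compactness argument (`exists_le_add_of_dist_le`).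
-/

namespace RefinedLaser

/-! ### Restrictions of tensors -/

section Restriction

variable {F : Type*} [Field F]

theorem sum_mul_sum_mul_sum {X Y Z : Type*} [Fintype X] [Fintype Y] [Fintype Z]
    (a : X → F) (b : Y → F) (c : Z → F) :
    (∑ x, a x) * (∑ y, b y) * (∑ z, c z) = ∑ x, ∑ y, ∑ z, a x * b y * c z := by
  simp only [Finset.sum_mul, Finset.mul_sum]
  rw [Finset.sum_comm]
  conv_lhs => enter [2, z]; rw [Finset.sum_comm]
  rw [Finset.sum_comm]

theorem Tensor.IsRestrictionOf.trans {X Y Z X' Y' Z' X'' Y'' Z'' : Type*}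
    [Fintype X] [Fintype Y] [Fintype Z] [Fintype X'] [Fintype Y'] [Fintype Z']
    {T'' : Tensor F X'' Y'' Z''} {T' : Tensor F X' Y' Z'} {T : Tensor F X Y Z}
    (h₂ : T''.IsRestrictionOf T') (h₁ : T'.IsRestrictionOf T) : T''.IsRestrictionOf T := by
  obtain ⟨A, B, C, h⟩ := h₁
  obtain ⟨A', B', C', h'⟩ := h₂
  refine ⟨A * A', B * B', C * C', fun x y z => ?_⟩
  rw [h']
  simp only [h, Matrix.mul_apply, sum_mul_sum_mul_sum]
  simp only [Finset.sum_mul, Finset.mul_sum, ← Fintype.sum_prod_type']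
  refine Fintype.sum_equiv
    ⟨fun p => (p.2.2.2.1, p.2.2.2.2.1, p.2.2.2.2.2, p.1, p.2.1, p.2.2.1),
      fun p => (p.2.2.2.1, p.2.2.2.2.1, p.2.2.2.2.2, p.1, p.2.1, p.2.2.1),
      fun _ => rfl, fun _ => rfl⟩ _ _ fun p => ?_
  simp only [Equiv.coe_fn_mk]
  ring

theorem Tensor.exists_ne_zero {X Y Z : Type*} {T : Tensor F X Y Z} (hT : T ≠ 0) :
    ∃ x y z, T x y z ≠ 0 := by
  by_contra! h
  exact hT (by funext x y z; exact h x y z)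

/-- Renaming, deleting, duplicating and rescaling variables gives a restriction. -/
theorem isRestrictionOf_monomial {X Y Z X' Y' Z' : Type*}
    [Fintype X] [Fintype Y] [Fintype Z] (T : Tensor F X Y Z)
    (φ : X' → X) (ψ : Y' → Y) (χ : Z' → Z) (a : X' → F) (b : Y' → F) (c : Z' → F) :
    Tensor.IsRestrictionOf (fun x y z => a x * b y * c z * T (φ x) (ψ y) (χ z)) T := by
  classical
  refine ⟨fun x x' => if x = φ x' then a x' else 0, fun y y' => if y = ψ y' then b y' else 0,
    fun z z' => if z = χ z' then c z' else 0, fun x' y' z' => ?_⟩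
  simp [mul_comm, mul_left_comm]

theorem isRestrictionOf_comp {X Y Z X' Y' Z' : Type*}
    [Fintype X] [Fintype Y] [Fintype Z] (T : Tensor F X Y Z)
    (φ : X' → X) (ψ : Y' → Y) (χ : Z' → Z) :
    Tensor.IsRestrictionOf (fun x y z => T (φ x) (ψ y) (χ z)) T := by
  simpa using isRestrictionOf_monomial T φ ψ χ (fun _ => 1) (fun _ => 1) (fun _ => 1)

/-- The Kronecker product of a finite family of tensors. -/
def piKron {ι : Type*} [Fintype ι] {X Y Z : ι → Type*} (T : ∀ l, Tensor F (X l) (Y l) (Z l)) :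
    Tensor F (∀ l, X l) (∀ l, Y l) (∀ l, Z l) :=
  fun x y z => ∏ l, T l (x l) (y l) (z l)

theorem piKron_isRestrictionOf {ι : Type*} [Fintype ι] [DecidableEq ι]
    {X Y Z X' Y' Z' : ι → Type*}
    [∀ l, Fintype (X l)] [∀ l, Fintype (Y l)] [∀ l, Fintype (Z l)]
    {T' : ∀ l, Tensor F (X' l) (Y' l) (Z' l)} {T : ∀ l, Tensor F (X l) (Y l) (Z l)}
    (h : ∀ l, (T' l).IsRestrictionOf (T l)) : (piKron T').IsRestrictionOf (piKron T) := by
  choose A B C h using h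
  refine ⟨fun x x' => ∏ l, A l (x l) (x' l), fun x x' => ∏ l, B l (x l) (x' l),
    fun x x' => ∏ l, C l (x l) (x' l), fun x' y' z' => ?_⟩
  simp only [piKron, h, Fintype.prod_sum, ← Finset.prod_mul_distrib]

end Restriction

/-! ### Direct sums of matrix multiplication tensors -/

section Achieves

variable {F : Type*} [Field F]

open Classical in
/-- The direct sum over `i : κ` of the matrix multiplication tensors with rows and columns indexed
by the types `A i`, `B i`, `C i`. -/
noncomputable def matMulSum (F : Type*) [Field F] {κ : Type} (A B C : κ → Type) :
    Tensor F (Σ i, A i × B i) (Σ i, B i × C i) (Σ i, C i × A i) :=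
  fun x y z => if ∃ i a b c, x = ⟨i, a, b⟩ ∧ y = ⟨i, b, c⟩ ∧ z = ⟨i, c, a⟩ then 1 else 0

/-- `Achieves τ T v` says that a direct sum of matrix multiplication tensors `⟨a i, b i, c i⟩` with
`v = ∑ i, (a i * b i * c i) ^ τ` is a restriction of `T`. Index sets are arbitrary finite types,
so that products and sums of such families need no renumbering. -/
def Achieves {X Y Z : Type*} [Fintype X] [Fintype Y] [Fintype Z] (τ : ℝ) (T : Tensor F X Y Z)
    (v : ℝ) : Prop :=
  ∃ (κ : Type) (_ : Fintype κ) (A B C : κ → Type),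
    (∀ i, Finite (A i) ∧ Nonempty (A i)) ∧ (∀ i, Finite (B i) ∧ Nonempty (B i)) ∧
    (∀ i, Finite (C i) ∧ Nonempty (C i)) ∧
    (matMulSum F A B C).IsRestrictionOf T ∧
    v = ∑ i, ((Nat.card (A i) * Nat.card (B i) * Nat.card (C i) : ℕ) : ℝ) ^ τ

theorem directSum_matMul {m : ℕ} (a b c : Fin m → ℕ) :
    (directSum fun i => matMul F (a i) (b i) (c i)) =
      matMulSum F (fun i => Fin (a i)) (fun i => Fin (b i)) (fun i => Fin (c i)) := by
  funext ⟨i, p, q⟩ ⟨j, r, s⟩ ⟨k, t, u⟩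
  by_cases h : j = i ∧ k = i
  · obtain ⟨rfl, rfl⟩ := h
    rw [directSum_same]
    unfold matMul matMulSum
    congr 1
    apply propext
    constructor
    · rintro ⟨h1, h2, h3⟩
      dsimp only at h1 h2 h3
      subst h1 h2 h3
      exact ⟨_, _, _, _, rfl, rfl, rfl⟩
    · rintro ⟨i, a, b, c, h1, h2, h3⟩
      cases h1
      cases h2
      cases h3
      exact ⟨rfl, rfl, rfl⟩
  · rw [directSum_ne _ _ _ _ h, matMulSum, if_neg]
    rintro ⟨i, a, b, c, h1, h2, h3⟩
    cases h1
    cases h2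
    cases h3
    exact h ⟨rfl, rfl⟩

variable {X Y Z X' Y' Z' : Type*} [Fintype X] [Fintype Y] [Fintype Z]
  [Fintype X'] [Fintype Y'] [Fintype Z'] {τ : ℝ}

theorem Achieves.mono {T' : Tensor F X' Y' Z'} {T : Tensor F X Y Z} {v : ℝ}
    (h : Achieves τ T' v) (hT : T'.IsRestrictionOf T) : Achieves τ T v := by
  obtain ⟨κ, i, A, B, C, hA, hB, hC, hr, hv⟩ := h
  exact ⟨κ, i, A, B, C, hA, hB, hC, hr.trans hT, hv⟩

theorem achieves_of_directSum {T : Tensor F X Y Z} {m : ℕ} {a b c : Fin m → ℕ}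
    (hpos : ∀ i, 0 < a i ∧ 0 < b i ∧ 0 < c i)
    (h : (directSum fun i => matMul F (a i) (b i) (c i)).IsRestrictionOf T) :
    Achieves τ T (∑ i, ((a i * b i * c i : ℕ) : ℝ) ^ τ) := by
  refine ⟨Fin m, inferInstance, fun i => Fin (a i), fun i => Fin (b i), fun i => Fin (c i),
    fun i => ⟨inferInstance, ⟨⟨0, (hpos i).1⟩⟩⟩, fun i => ⟨inferInstance, ⟨⟨0, (hpos i).2.1⟩⟩⟩,
    fun i => ⟨inferInstance, ⟨⟨0, (hpos i).2.2⟩⟩⟩, ?_, by simp⟩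
  rwa [← directSum_matMul]

theorem Achieves.exists_directSum {T : Tensor F X Y Z} {v : ℝ} (h : Achieves τ T v) :
    ∃ (m : ℕ) (a b c : Fin m → ℕ), (∀ i, 0 < a i ∧ 0 < b i ∧ 0 < c i) ∧
      (directSum fun i => matMul F (a i) (b i) (c i)).IsRestrictionOf T ∧
      v = ∑ i, ((a i * b i * c i : ℕ) : ℝ) ^ τ := by
  obtain ⟨κ, iκ, A, B, C, hA, hB, hC, hr, hv⟩ := h
  have := fun i => (hA i).1
  have := fun i => (hA i).2
  have := fun i => (hB i).1
  have := fun i => (hB i).2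
  have := fun i => (hC i).1
  have := fun i => (hC i).2
  let e := (Fintype.equivFin κ).symm
  refine ⟨Fintype.card κ, fun j => Nat.card (A (e j)), fun j => Nat.card (B (e j)),
    fun j => Nat.card (C (e j)), fun i => ⟨Nat.card_pos, Nat.card_pos, Nat.card_pos⟩, ?_, ?_⟩
  · obtain ⟨A', B', C', hr⟩ := hr
    let fA : ∀ j, Fin (Nat.card (A (e j))) ≃ A (e j) := fun j => (Finite.equivFin _).symm
    let fB : ∀ j, Fin (Nat.card (B (e j))) ≃ B (e j) := fun j => (Finite.equivFin _).symm
    let fC : ∀ j, Fin (Nat.card (C (e j))) ≃ C (e j) := fun j => (Finite.equivFin _).symm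
    refine ⟨fun x x' => A' x ⟨e x'.1, fA _ x'.2.1, fB _ x'.2.2⟩,
      fun y y' => B' y ⟨e y'.1, fB _ y'.2.1, fC _ y'.2.2⟩,
      fun z z' => C' z ⟨e z'.1, fC _ z'.2.1, fA _ z'.2.2⟩, fun x y z => ?_⟩
    rw [← hr, directSum_matMul]
    unfold matMulSum
    congr 1
    apply propext
    constructor
    · rintro ⟨i, a, b, c, rfl, rfl, rfl⟩
      exact ⟨_, _, _, _, rfl, rfl, rfl⟩
    · rintro ⟨i, a, b, c, h1, h2, h3⟩
      obtain ⟨i1, p, q⟩ := x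
      obtain ⟨i2, r, s⟩ := y
      obtain ⟨i3, t, u⟩ := z
      obtain rfl : e i1 = i := congrArg Sigma.fst h1
      obtain rfl : i2 = i1 := e.injective (congrArg Sigma.fst h2)
      obtain rfl : i3 = i2 := e.injective (congrArg Sigma.fst h3)
      simp only [Sigma.mk.injEq, heq_eq_eq, Prod.mk.injEq, true_and] at h1 h2 h3
      obtain rfl : q = r := (fB _).injective (h1.2.trans h2.1.symm)
      obtain rfl : s = t := (fC _).injective (h2.2.trans h3.1.symm)
      obtain rfl : u = p := (fA _).injective (h3.2.trans h1.1.symm)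
      exact ⟨_, _, _, _, rfl, rfl, rfl⟩
  · rw [hv]
    exact (Fintype.sum_equiv e _ _ fun j => rfl).symm

theorem Achieves.le_value {T : Tensor F X Y Z} {n : ℕ} (hn : 0 < n) {v : ℝ}
    (h : Achieves τ (((T.kron T.rot).kron T.rot.rot).kronPow n) v) :
    ENNReal.ofReal (v ^ (1 / (3 * (n : ℝ)))) ≤ value τ T := by
  obtain ⟨m, a, b, c, hpos, hr, rfl⟩ := h.exists_directSum
  exact le_sSup ⟨n, m, a, b, c, hn, hpos, hr, rfl⟩

theorem Achieves.nonneg {T : Tensor F X Y Z} {v : ℝ} (h : Achieves τ T v) : 0 ≤ v := by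
  obtain ⟨κ, iκ, A, B, C, hA, hB, hC, hr, rfl⟩ := h
  positivity

theorem achieves_one {T : Tensor F X Y Z} (hT : T ≠ 0) : Achieves τ T 1 := by
  obtain ⟨x, y, z, h⟩ := Tensor.exists_ne_zero hT
  refine ⟨Unit, inferInstance, fun _ => Unit, fun _ => Unit, fun _ => Unit,
    fun _ => ⟨inferInstance, inferInstance⟩, fun _ => ⟨inferInstance, inferInstance⟩,
    fun _ => ⟨inferInstance, inferInstance⟩, ?_, by simp⟩
  convert isRestrictionOf_monomial T (fun _ => x) (fun _ => y) (fun _ => z)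
    (fun _ => (T x y z)⁻¹) (fun _ => 1) (fun _ => 1) using 4 with x' y' z'
  simp only [matMulSum, mul_one, inv_mul_cancel₀ h, ite_eq_left_iff]
  intro h'
  exact absurd ⟨(), (), (), (), by trivial⟩ h'

/-- Sums of matrix multiplication tensors multiply under Kronecker products. -/
theorem achieves_piKron {ι : Type} [Fintype ι] [DecidableEq ι] {X Y Z : ι → Type*}
    [∀ l, Fintype (X l)] [∀ l, Fintype (Y l)] [∀ l, Fintype (Z l)]
    {T : ∀ l, Tensor F (X l) (Y l) (Z l)}
    {v : ι → ℝ} (h : ∀ l, Achieves τ (T l) (v l)) : Achieves τ (piKron T) (∏ l, v l) := by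
  classical
  choose κ iκ A B C hA hB hC hr hv using h
  have := fun l i => (hA l i).1
  have := fun l i => (hA l i).2
  have := fun l i => (hB l i).1
  have := fun l i => (hB l i).2
  have := fun l i => (hC l i).1
  have := fun l i => (hC l i).2
  refine ⟨∀ l, κ l, inferInstance, fun i => ∀ l, A l (i l), fun i => ∀ l, B l (i l),
    fun i => ∀ l, C l (i l), fun i => ⟨inferInstance, inferInstance⟩,
    fun i => ⟨inferInstance, inferInstance⟩, fun i => ⟨inferInstance, inferInstance⟩, ?_, ?_⟩
  · obtain ⟨A', B', C', hr⟩ := piKron_isRestrictionOf hr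
    refine ⟨fun x x' => A' x fun l => ⟨x'.1 l, x'.2.1 l, x'.2.2 l⟩,
      fun y y' => B' y fun l => ⟨y'.1 l, y'.2.1 l, y'.2.2 l⟩,
      fun z z' => C' z fun l => ⟨z'.1 l, z'.2.1 l, z'.2.2 l⟩, fun x y z => ?_⟩
    rw [← hr, piKron]
    unfold matMulSum
    have prod_indicator : ∀ p : ι → Prop, (∏ l, if p l then (1 : F) else 0) =
        if ∀ l, p l then 1 else 0 := fun p => by
      rw [Finset.prod_boole]
      simp
    refine Eq.trans ?_ (prod_indicator _).symm
    congr 1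
    apply propext
    constructor
    · rintro ⟨i, a, b, c, rfl, rfl, rfl⟩ l
      exact ⟨_, _, _, _, rfl, rfl, rfl⟩
    · intro h
      obtain ⟨i, p, q⟩ := x
      obtain ⟨j, r, s⟩ := y
      obtain ⟨k, t, u⟩ := z
      obtain rfl : i = j := by
        funext l
        obtain ⟨i', a, b, c, h1, h2, h3⟩ := h l
        exact (congrArg Sigma.fst h1).trans (congrArg Sigma.fst h2).symm
      obtain rfl : i = k := by
        funext l
        obtain ⟨i', a, b, c, h1, h2, h3⟩ := h l
        exact (congrArg Sigma.fst h1).trans (congrArg Sigma.fst h3).symm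
      have key : ∀ l, q l = r l ∧ s l = t l ∧ u l = p l := by
        intro l
        obtain ⟨i', a, b, c, h1, h2, h3⟩ := h l
        obtain rfl : i l = i' := congrArg Sigma.fst h1
        simp only [Sigma.mk.injEq, heq_eq_eq, Prod.mk.injEq, true_and] at h1 h2 h3
        exact ⟨h1.2.trans h2.1.symm, h2.2.trans h3.1.symm, h3.2.trans h1.1.symm⟩
      obtain rfl : q = r := funext fun l => (key l).1
      obtain rfl : s = t := funext fun l => (key l).2.1
      obtain rfl : u = p := funext fun l => (key l).2.2
      exact ⟨_, _, _, _, rfl, rfl, rfl⟩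
  · simp only [hv, Fintype.prod_sum]
    refine Finset.sum_congr rfl fun i _ => ?_
    rw [Real.finsetProd_rpow _ _ fun _ _ => by positivity]
    simp only [Nat.card_pi, Nat.cast_mul, Nat.cast_prod, Finset.prod_mul_distrib]

open Classical in
/-- The direct sum of a family of tensors over the same variable sets. -/
noncomputable def copySum {D : Type*} (U : D → Tensor F X Y Z) :
    Tensor F (D × X) (D × Y) (D × Z) :=
  fun x y z => if y.1 = x.1 ∧ z.1 = x.1 then U x.1 x.2 y.2 z.2 else 0

theorem achieves_copySum {D : Type} [Fintype D] {U : D → Tensor F X Y Z}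
    {v : D → ℝ} (h : ∀ d, Achieves τ (U d) (v d)) : Achieves τ (copySum U) (∑ d, v d) := by
  classical
  choose κ iκ A B C hA hB hC hr hv using h
  refine ⟨Σ d, κ d, inferInstance, fun i => A i.1 i.2, fun i => B i.1 i.2, fun i => C i.1 i.2,
    fun i => hA i.1 i.2, fun i => hB i.1 i.2, fun i => hC i.1 i.2, ?_, ?_⟩
  · choose A' B' C' hr using hr
    refine ⟨fun x x' => if x.1 = x'.1.1 then A' x'.1.1 x.2 ⟨x'.1.2, x'.2⟩ else 0,
      fun x x' => if x.1 = x'.1.1 then B' x'.1.1 x.2 ⟨x'.1.2, x'.2⟩ else 0,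
      fun x x' => if x.1 = x'.1.1 then C' x'.1.1 x.2 ⟨x'.1.2, x'.2⟩ else 0, ?_⟩
    rintro ⟨⟨d, i⟩, p, q⟩ ⟨⟨d', i'⟩, r, s⟩ ⟨⟨d'', i''⟩, t, u⟩
    simp only [Fintype.sum_prod_type, copySum]
    rw [Finset.sum_eq_single d (by intro b _ hb; simp [hb]) (by simp)]
    conv_rhs =>
      enter [2, x]
      rw [Finset.sum_eq_single d' (by intro b _ hb; simp [hb]) (by simp)]
      enter [2, y]
      rw [Finset.sum_eq_single d'' (by intro b _ hb; simp [hb]) (by simp)]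
    by_cases h : d' = d ∧ d'' = d
    · obtain ⟨rfl, rfl⟩ := h
      simp only [and_self, if_true]
      rw [← hr, matMulSum, matMulSum]
      congr 1
      apply propext
      constructor
      · rintro ⟨i, a, b, c, h1, h2, h3⟩
        cases h1
        cases h2
        cases h3
        exact ⟨_, _, _, _, rfl, rfl, rfl⟩
      · rintro ⟨i, a, b, c, h1, h2, h3⟩
        cases h1
        cases h2
        cases h3
        exact ⟨_, _, _, _, rfl, rfl, rfl⟩
    · simp only [if_neg h, zero_mul, Finset.sum_const_zero]
      rw [matMulSum, if_neg]
      rintro ⟨i, a, b, c, h1, h2, h3⟩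
      cases h1
      cases h2
      cases h3
      exact h ⟨rfl, rfl⟩
  · simp only [hv, Fintype.sum_sigma]

end Achieves

/-! ### Induced matchings from hashing and random colouring -/

section Matching

theorem card_fiber_mul_card {G H : Type*} [AddGroup G] [AddGroup H] [Fintype G] [Fintype H]
    [DecidableEq H] (f : G →+ H) (hf : Function.Surjective f) (h : H) :
    (Finset.univ.filter fun g => f g = h).card * Fintype.card H = Fintype.card G := by
  have key : Fintype.card G = ∑ h' : H, (Finset.univ.filter fun g => f g = h').card :=
    Finset.card_eq_sum_card_fiberwise (f := f) (s := Finset.univ) (t := Finset.univ)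
      fun _ _ => by simp
  rw [key, Finset.sum_congr rfl fun h' _ => AddMonoidHom.card_fiber_eq_of_mem_range f (hf h') (hf h)]
  simp [mul_comm]

/-- A sparse 3-uniform hypergraph has a large independent set: colour the vertices randomly with
`Q` colours, pick the best colour class, and delete a vertex from each of its edges. -/
theorem exists_independent_set {V : Type*} [Fintype V] [DecidableEq V] (G : Finset V)
    (E : Finset (V × V × V)) (hE : ∀ e ∈ E, e.1 ≠ e.2.1 ∧ e.1 ≠ e.2.2 ∧ e.2.1 ≠ e.2.2)
    (Q : ℕ) (hQ : 0 < Q) :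
    ∃ G' ⊆ G, (∀ e ∈ E, ¬ (e.1 ∈ G' ∧ e.2.1 ∈ G' ∧ e.2.2 ∈ G')) ∧
      G.card * Q ^ 2 ≤ G'.card * Q ^ 3 + E.card := by
  classical
  have : NeZero Q := ⟨hQ.ne'⟩
  let mono : (V → ZMod Q) → Finset (V × V × V) := fun χ =>
    E.filter fun e => χ e.1 = χ e.2.1 ∧ χ e.1 = χ e.2.2
  have count : ∀ e ∈ E, (Finset.univ.filter fun χ : V → ZMod Q =>
      χ e.1 = χ e.2.1 ∧ χ e.1 = χ e.2.2).card * Q ^ 2 = Fintype.card (V → ZMod Q) := by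
    intro e he
    obtain ⟨h1, h2, h3⟩ := hE e he
    let f : (V → ZMod Q) →+ ZMod Q × ZMod Q :=
      { toFun := fun χ => (χ e.1 - χ e.2.1, χ e.1 - χ e.2.2)
        map_zero' := by simp
        map_add' := fun χ χ' => by
          ext
          · simp only [Pi.add_apply, Prod.fst_add]; ring
          · simp only [Pi.add_apply, Prod.snd_add]; ring }
    have hf : Function.Surjective f := by
      rintro ⟨a, b⟩
      refine ⟨Pi.single e.2.1 (-a) + Pi.single e.2.2 (-b), ?_⟩
      simp [f, h1, h2, h3, h3.symm]
    have := card_fiber_mul_card f hf 0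
    rw [← this]
    simp only [f, AddMonoidHom.coe_mk, ZeroHom.coe_mk, Prod.mk_eq_zero, sub_eq_zero,
      Fintype.card_prod, ZMod.card, sq]
  obtain ⟨χ, hχ⟩ : ∃ χ : V → ZMod Q, (mono χ).card * Q ^ 2 ≤ E.card := by
    have hsum : ∑ χ : V → ZMod Q, (mono χ).card * Q ^ 2 ≤ ∑ χ : V → ZMod Q, E.card := by
      rw [← Finset.sum_mul]
      simp only [mono, Finset.card_filter]
      rw [Finset.sum_comm, Finset.sum_mul]
      simp only [← Finset.card_filter]
      rw [Finset.sum_congr rfl count]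
      simp [mul_comm]
    obtain ⟨χ, -, h⟩ := Finset.exists_le_of_sum_le Finset.univ_nonempty hsum
    exact ⟨χ, h⟩
  obtain ⟨k, hk⟩ : ∃ k : ZMod Q, (G.card : ℤ) - (mono χ).card ≤
      Q * ((G.filter fun v => χ v = k).card - ((mono χ).filter fun e => χ e.1 = k).card) := by
    have hsum : ∑ k : ZMod Q, ((G.card : ℤ) - (mono χ).card) ≤ ∑ k : ZMod Q,
        Q * (((G.filter fun v => χ v = k).card : ℤ) -
          ((mono χ).filter fun e => χ e.1 = k).card) := by
      rw [← Finset.mul_sum, Finset.sum_sub_distrib, Finset.sum_sub_distrib, ← Nat.cast_sum (Finset.univ) (fun k => (G.filter fun v => χ v = k).card),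
        ← Nat.cast_sum (Finset.univ) (fun k => ((mono χ).filter fun e => χ e.1 = k).card),
        ← Finset.card_eq_sum_card_fiberwise (f := χ) (t := Finset.univ) (fun _ _ => by simp),
        ← Finset.card_eq_sum_card_fiberwise (f := fun e : V × V × V => χ e.1) (t := Finset.univ)
          (fun _ _ => by simp)]
      simp only [Finset.sum_const, Finset.card_univ, ZMod.card,
        nsmul_eq_mul]
      linarith
    obtain ⟨k, -, h⟩ := Finset.exists_le_of_sum_le Finset.univ_nonempty hsum
    exact ⟨k, h⟩
  let B := ((mono χ).filter fun e => χ e.1 = k).image fun e => e.1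
  refine ⟨(G.filter fun v => χ v = k) \ B,
    Finset.sdiff_subset.trans (Finset.filter_subset _ _), ?_, ?_⟩
  · rintro e he ⟨h1, h2, h3⟩
    simp only [Finset.mem_sdiff, Finset.mem_filter] at h1 h2 h3
    refine h1.2 (Finset.mem_image.2 ⟨e, ?_, rfl⟩)
    simp only [mono, Finset.mem_filter]
    exact ⟨⟨he, h1.1.2.trans h2.1.2.symm, h1.1.2.trans h3.1.2.symm⟩, h1.1.2⟩
  · have h1 := Finset.le_card_sdiff B (G.filter fun v => χ v = k)
    have h2 : B.card ≤ ((mono χ).filter fun e => χ e.1 = k).card := Finset.card_image_le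
    set g := ((G.filter fun v => χ v = k) \ B).card
    have h3 : ((G.filter fun v => χ v = k).card : ℤ) -
        ((mono χ).filter fun e => χ e.1 = k).card ≤ g := by omega
    have h4 : (G.card : ℤ) ≤ Q * g + (mono χ).card := by nlinarith
    have h5 : G.card ≤ Q * g + (mono χ).card := by exact_mod_cast h4
    calc G.card * Q ^ 2 ≤ (Q * g + (mono χ).card) * Q ^ 2 := by gcongr
      _ = g * Q ^ 3 + (mono χ).card * Q ^ 2 := by ring
      _ ≤ _ := by gcongr

variable {M : ℕ} [Fact M.Prime] {ι : Type*} [Fintype ι]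

/-- Two triples share a coordinate. -/
def Meets {V : Type*} (p q : V × V × V) : Prop :=
  p.1 = q.1 ∨ p.2.1 = q.2.1 ∨ p.2.2 = q.2.2

/-- The coefficients of the two hash functions `w ⬝ x + u` and `w ⬝ y + v`. -/
abbrev HashCoeff (M : ℕ) (ι : Type*) := (ι → ZMod M) × ZMod M × ZMod M

/-- The hash `w ⬝ x + u` of a first coordinate, as a homomorphism in its coefficients. -/
def hashX (x : ι → ZMod M) : HashCoeff M ι →+ ZMod M where
  toFun ω := ω.1 ⬝ᵥ x + ω.2.1
  map_zero' := by simp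
  map_add' a b := by simp only [Prod.fst_add, Prod.snd_add, add_dotProduct]; ring

/-- The hash `w ⬝ y + v` of a second coordinate, as a homomorphism in its coefficients. -/
def hashY (y : ι → ZMod M) : HashCoeff M ι →+ ZMod M where
  toFun ω := ω.1 ⬝ᵥ y + ω.2.2
  map_zero' := by simp
  map_add' a b := by simp only [Prod.fst_add, Prod.snd_add, add_dotProduct]; ring

theorem hashX_apply (x : ι → ZMod M) (ω : HashCoeff M ι) : hashX x ω = ω.1 ⬝ᵥ x + ω.2.1 := rfl

theorem hashY_apply (y : ι → ZMod M) (ω : HashCoeff M ι) : hashY y ω = ω.1 ⬝ᵥ y + ω.2.2 := rfl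

theorem two_ne_zero_of_prime_ne_two (hM : M ≠ 2) : (2 : ZMod M) ≠ 0 := by
  have : ((2 : ℕ) : ZMod M) ≠ 0 := by
    rw [Ne, ZMod.natCast_eq_zero_iff]
    intro h
    exact hM ((Nat.prime_dvd_prime_iff_eq Fact.out Nat.prime_two).1 h)
  exact_mod_cast this

/-- The hash of the third coordinate: the mean of the two others when `x + y + z = c`. -/
def hashZ (c : ι → ZMod M) (ω : HashCoeff M ι) (z : ι → ZMod M) : ZMod M :=
  (ω.1 ⬝ᵥ (c - z) + ω.2.1 + ω.2.2) / 2

/-- All three coordinates hash into `S`. -/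
def Survives (c : ι → ZMod M) (S : Finset (ZMod M)) (ω : HashCoeff M ι)
    (p : (ι → ZMod M) × (ι → ZMod M) × (ι → ZMod M)) : Prop :=
  hashX p.1 ω ∈ S ∧ hashY p.2.1 ω ∈ S ∧ hashZ c ω p.2.2 ∈ S

theorem hashX_add_hashY (hM : M ≠ 2) {c : ι → ZMod M} (ω : HashCoeff M ι)
    {p : (ι → ZMod M) × (ι → ZMod M) × (ι → ZMod M)} (hp : p.1 + p.2.1 + p.2.2 = c) :
    hashX p.1 ω + hashY p.2.1 ω = hashZ c ω p.2.2 + hashZ c ω p.2.2 := by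
  have h2 := two_ne_zero_of_prime_ne_two hM
  rw [hashX_apply, hashY_apply, hashZ, ← hp, add_sub_cancel_right, dotProduct_add]
  field_simp
  ring

/-- As `S` has no three-term progression, the hashes of a surviving triple all agree. -/
theorem Survives.hash_eq (hM : M ≠ 2) {c : ι → ZMod M} {S : Finset (ZMod M)}
    (hS : ThreeAPFree (S : Set (ZMod M))) {ω : HashCoeff M ι}
    {p : (ι → ZMod M) × (ι → ZMod M) × (ι → ZMod M)} (hp : p.1 + p.2.1 + p.2.2 = c)
    (h : Survives c S ω p) :
    hashX p.1 ω = hashZ c ω p.2.2 ∧ hashY p.2.1 ω = hashZ c ω p.2.2 := by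
  have h1 := hashX_add_hashY hM ω hp
  have h2 := hS h.1 h.2.2 h.2.1 h1
  refine ⟨h2, ?_⟩
  rw [h2] at h1
  exact add_left_cancel h1

open Classical in
/-- A triple survives if two independent hash values agree and lie in `S`. -/
theorem card_survives (hM : M ≠ 2) {c : ι → ZMod M} {S : Finset (ZMod M)}
    (hS : ThreeAPFree (S : Set (ZMod M)))
    {p : (ι → ZMod M) × (ι → ZMod M) × (ι → ZMod M)} (hp : p.1 + p.2.1 + p.2.2 = c) :
    (Finset.univ.filter fun ω : HashCoeff M ι => Survives c S ω p).card * M ^ 2 =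
      S.card * Fintype.card (HashCoeff M ι) := by
  let f : HashCoeff M ι →+ ZMod M × ZMod M := (hashX p.1).prod (hashY p.2.1)
  have hf : Function.Surjective f := by
    rintro ⟨a, b⟩
    exact ⟨(0, a, b), by simp [f, hashX_apply, hashY_apply]⟩
  have h2 := two_ne_zero_of_prime_ne_two hM
  have hset : (Finset.univ.filter fun ω : HashCoeff M ι => Survives c S ω p) =
      S.biUnion fun s => Finset.univ.filter fun ω => f ω = (s, s) := by
    ext ω
    simp only [Finset.mem_filter, Finset.mem_univ, true_and, Finset.mem_biUnion, f,
      AddMonoidHom.prod_apply, Prod.mk.injEq]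
    constructor
    · intro h
      obtain ⟨h1, h2⟩ := h.hash_eq hM hS hp
      exact ⟨_, h.2.2, h1, h2⟩
    · rintro ⟨s, hs, h1, h2'⟩
      have h3 := hashX_add_hashY hM ω hp
      rw [h1, h2', ← two_mul, ← two_mul] at h3
      have h4 := mul_left_cancel₀ h2 h3
      exact ⟨h1 ▸ hs, h2' ▸ hs, h4 ▸ hs⟩
  rw [hset, Finset.card_biUnion, Finset.sum_mul]
  · rw [Finset.sum_congr rfl fun s _ => ?_, Finset.sum_const, smul_eq_mul]
    rw [← card_fiber_mul_card f hf (s, s)]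
    simp [sq]
  · intro s _ t _ hst
    refine Finset.disjoint_filter.2 fun ω _ h1 h2 => hst ?_
    rw [h1] at h2
    exact congrArg Prod.fst h2

theorem exists_dotProduct_sub_eq {x x' : ι → ZMod M} (h : x ≠ x') (a : ZMod M) :
    ∃ w : ι → ZMod M, w ⬝ᵥ x' = w ⬝ᵥ x + a := by
  classical
  obtain ⟨l, hl⟩ := Function.ne_iff.1 h
  refine ⟨Pi.single l (a / (x' l - x l)), ?_⟩
  have : x' l - x l ≠ 0 := sub_ne_zero.2 hl.symm
  simp only [single_dotProduct]
  field_simp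
  ring

open Classical in
/-- Two distinct triples that share a coordinate survive together only if three independent hash
values agree. -/
theorem card_survives_pair (hM : M ≠ 2) {c : ι → ZMod M} {S : Finset (ZMod M)}
    (hS : ThreeAPFree (S : Set (ZMod M)))
    {p q : (ι → ZMod M) × (ι → ZMod M) × (ι → ZMod M)} (hp : p.1 + p.2.1 + p.2.2 = c)
    (hq : q.1 + q.2.1 + q.2.2 = c) (hpq : p ≠ q) (hm : Meets p q) :
    (Finset.univ.filter fun ω : HashCoeff M ι => Survives c S ω p ∧ Survives c S ω q).card
      * M ^ 3 ≤ S.card * Fintype.card (HashCoeff M ι) := by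
  -- the third hash value is that of `q.1` if `p.1 ≠ q.1`, and that of `q.2.1` otherwise
  obtain ⟨f, hf, hfs⟩ : ∃ f : HashCoeff M ι →+ ZMod M × ZMod M × ZMod M,
      Function.Surjective f ∧ ∀ ω, Survives c S ω p → Survives c S ω q → ∃ s ∈ S,
        f ω = (s, s, s) := by
    have hs : ∀ ω, Survives c S ω p → Survives c S ω q →
        hashX p.1 ω ∈ S ∧ hashY p.2.1 ω = hashX p.1 ω ∧ hashX q.1 ω = hashX p.1 ω ∧
          hashY q.2.1 ω = hashX p.1 ω := by
      intro ω h1 h2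
      obtain ⟨a1, a2⟩ := h1.hash_eq hM hS hp
      obtain ⟨b1, b2⟩ := h2.hash_eq hM hS hq
      refine ⟨h1.1, a2.trans a1.symm, ?_⟩
      rcases hm with h | h | h
      · rw [h]; exact ⟨rfl, b2.trans b1.symm⟩
      · rw [a1, ← a2, h, b1, b2]; exact ⟨rfl, rfl⟩
      · rw [a1, b1, b2, h]; exact ⟨rfl, rfl⟩
    by_cases hx : p.1 = q.1
    · have hy : p.2.1 ≠ q.2.1 := by
        intro hy
        have hz : p.2.2 = q.2.2 := by
          rw [← hq, hx, hy] at hp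
          exact add_left_cancel hp
        exact hpq (Prod.ext hx (Prod.ext hy hz))
      refine ⟨(hashX p.1).prod ((hashY p.2.1).prod (hashY q.2.1)), ?_, ?_⟩
      · rintro ⟨a, b, d⟩
        obtain ⟨w, hw⟩ := exists_dotProduct_sub_eq hy (d - b)
        refine ⟨(w, a - w ⬝ᵥ p.1, b - w ⬝ᵥ p.2.1), ?_⟩
        simp [hashX_apply, hashY_apply, hw]
        ring
      · intro ω h1 h2
        obtain ⟨e1, e2, e3, e4⟩ := hs ω h1 h2
        exact ⟨_, e1, by simp [e2, e4]⟩
    · refine ⟨(hashX p.1).prod ((hashY p.2.1).prod (hashX q.1)), ?_, ?_⟩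
      · rintro ⟨a, b, d⟩
        obtain ⟨w, hw⟩ := exists_dotProduct_sub_eq hx (d - a)
        refine ⟨(w, a - w ⬝ᵥ p.1, b - w ⬝ᵥ p.2.1), ?_⟩
        simp [hashX_apply, hashY_apply, hw]
        ring
      · intro ω h1 h2
        obtain ⟨e1, e2, e3, e4⟩ := hs ω h1 h2
        exact ⟨_, e1, by simp [e2, e3]⟩
  calc _ ≤ (S.biUnion fun s => Finset.univ.filter fun ω => f ω = (s, s, s)).card * M ^ 3 := by
        gcongr
        intro ω h
        simp only [Finset.mem_filter, Finset.mem_univ, true_and, Finset.mem_biUnion] at h ⊢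
        exact hfs ω h.1 h.2
    _ ≤ (∑ s ∈ S, (Finset.univ.filter fun ω => f ω = (s, s, s)).card) * M ^ 3 := by
        gcongr
        exact Finset.card_biUnion_le
    _ = S.card * Fintype.card (HashCoeff M ι) := by
        rw [Finset.sum_mul, Finset.sum_congr rfl fun s _ => ?_, Finset.sum_const, smul_eq_mul]
        rw [← card_fiber_mul_card f hf (s, s, s)]
        simp [pow_succ, mul_assoc]

open Classical in
theorem card_meets_le {V : Type*} (A : Finset (V × V × V)) (R : ℕ)
    (hX : ∀ x, (A.filter fun p => p.1 = x).card ≤ R)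
    (hY : ∀ y, (A.filter fun p => p.2.1 = y).card ≤ R)
    (hZ : ∀ z, (A.filter fun p => p.2.2 = z).card ≤ R) :
    ((A ×ˢ A).filter fun r => r.1 ≠ r.2 ∧ Meets r.1 r.2).card ≤ 3 * R * A.card := by
  calc _ ≤ ((A ×ˢ A).filter fun r => Meets r.1 r.2).card :=
        Finset.card_le_card (Finset.monotone_filter_right _ fun _ _ h => h.2)
    _ = ∑ p ∈ A, (A.filter fun q => Meets p q).card := by
        simp only [Finset.card_filter, Finset.sum_product]
    _ ≤ ∑ p ∈ A, 3 * R := by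
        refine Finset.sum_le_sum fun p _ => ?_
        have hsub : (A.filter fun q => Meets p q) ⊆ (A.filter fun q => q.1 = p.1) ∪
            ((A.filter fun q => q.2.1 = p.2.1) ∪ (A.filter fun q => q.2.2 = p.2.2)) := by
          intro q hq
          rw [Finset.mem_filter] at hq
          simp only [Finset.mem_filter, Finset.mem_union]
          rcases hq.2 with h | h | h
          · exact Or.inl ⟨hq.1, h.symm⟩
          · exact Or.inr (Or.inl ⟨hq.1, h.symm⟩)
          · exact Or.inr (Or.inr ⟨hq.1, h.symm⟩)
        have h1 := Finset.card_le_card hsub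
        have h2 := Finset.card_union_le (A.filter fun q => q.1 = p.1)
          ((A.filter fun q => q.2.1 = p.2.1) ∪ (A.filter fun q => q.2.2 = p.2.2))
        have h3 := Finset.card_union_le (A.filter fun q => q.2.1 = p.2.1)
          (A.filter fun q => q.2.2 = p.2.2)
        have := hX p.1
        have := hY p.2.1
        have := hZ p.2.2
        omega
    _ = 3 * R * A.card := by simp [mul_comm]

/-- `D` is an induced matching in `Φ`: a triple of `Φ` whose coordinates all occur in `D`, each in
the right position, takes them from a single triple of `D`. -/
def IsInducedMatching {V : Type*} (D Φ : Finset (V × V × V)) : Prop :=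
  ∀ p ∈ Φ, ∀ d₁ ∈ D, ∀ d₂ ∈ D, ∀ d₃ ∈ D, p.1 = d₁.1 → p.2.1 = d₂.2.1 → p.2.2 = d₃.2.2 →
    d₁ = d₂ ∧ d₁ = d₃

open Classical in
/-- A random affine hash, averaged over its coefficients: the expected number of surviving triples
of `A` exceeds that of the collisions among them and of the `Q⁻²`-fraction of surviving triples of
`Φ`. -/
theorem exists_good_hash (hM : M ≠ 2) {c : ι → ZMod M} {S : Finset (ZMod M)}
    (hS : ThreeAPFree (S : Set (ZMod M)))
    (Φ A : Finset ((ι → ZMod M) × (ι → ZMod M) × (ι → ZMod M)))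
    (hΦ : ∀ p ∈ Φ, p.1 + p.2.1 + p.2.2 = c) (hA : A ⊆ Φ) (R : ℕ)
    (hX : ∀ x, (A.filter fun p => p.1 = x).card ≤ R)
    (hY : ∀ y, (A.filter fun p => p.2.1 = y).card ≤ R)
    (hZ : ∀ z, (A.filter fun p => p.2.2 = z).card ≤ R)
    (hR : 12 * R ≤ M) (Q : ℕ) (hQ : 0 < Q) (hQ' : 4 * Φ.card ≤ A.card * Q ^ 2) :
    ∃ ω : HashCoeff M ι, (A.card * S.card : ℝ) / (2 * M ^ 2) ≤
      (A.filter (Survives c S ω)).card -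
      ((((A ×ˢ A).filter fun r => r.1 ≠ r.2 ∧ Meets r.1 r.2).filter
        fun r => Survives c S ω r.1 ∧ Survives c S ω r.2).card : ℝ) -
      (Φ.filter (Survives c S ω)).card / (Q : ℝ) ^ 2 := by
  set N := (A ×ˢ A).filter fun r => r.1 ≠ r.2 ∧ Meets r.1 r.2 with hN
  have hM0 : (0 : ℝ) < M := by exact_mod_cast (Fact.out : M.Prime).pos
  have hQ0 : (0 : ℝ) < Q := by exact_mod_cast hQ
  set W : ℝ := ((Fintype.card (HashCoeff M ι) : ℕ) : ℝ) with hW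
  have hW0 : 0 < W := by
    rw [hW]
    exact_mod_cast Fintype.card_pos
  have hone : ∀ B : Finset ((ι → ZMod M) × (ι → ZMod M) × (ι → ZMod M)), B ⊆ Φ →
      ∑ ω : HashCoeff M ι, ((B.filter (Survives c S ω)).card : ℝ) =
        B.card * (S.card * W / M ^ 2) := by
    intro B hB
    rw [← Nat.cast_sum]
    simp only [Finset.card_filter]
    rw [Finset.sum_comm]
    simp only [← Finset.card_filter]
    rw [Nat.cast_sum, Finset.sum_congr rfl fun p hp => ?_, Finset.sum_const, nsmul_eq_mul]
    rw [eq_div_iff (by positivity), hW]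
    exact_mod_cast card_survives hM hS (hΦ p (hB hp))
  have htwo : ∑ ω : HashCoeff M ι,
      ((N.filter fun r => Survives c S ω r.1 ∧ Survives c S ω r.2).card : ℝ) ≤
        N.card * (S.card * W / M ^ 3) := by
    rw [← Nat.cast_sum]
    simp only [Finset.card_filter]
    rw [Finset.sum_comm]
    simp only [← Finset.card_filter]
    rw [Nat.cast_sum, ← nsmul_eq_mul]
    refine Finset.sum_le_card_nsmul _ _ _ fun r hr => ?_
    simp only [hN, Finset.mem_filter, Finset.mem_product] at hr
    rw [le_div_iff₀ (by positivity), hW]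
    exact_mod_cast card_survives_pair hM hS (hΦ _ (hA hr.1.1)) (hΦ _ (hA hr.1.2)) hr.2.1 hr.2.2
  have hNc : (N.card : ℝ) ≤ 3 * R * A.card := by
    have h : N.card ≤ 3 * R * A.card := by
      convert card_meets_le A R (fun x => by convert hX x) (fun y => by convert hY y)
        (fun z => by convert hZ z)
    exact_mod_cast h
  have hR' : (12 * R : ℝ) ≤ M := by exact_mod_cast hR
  have hQ'' : (4 * Φ.card : ℝ) ≤ A.card * Q ^ 2 := by exact_mod_cast hQ'
  have hsum : ∑ ω : HashCoeff M ι, (A.card * S.card : ℝ) / (2 * M ^ 2) ≤ ∑ ω : HashCoeff M ι,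
      (((A.filter (Survives c S ω)).card : ℝ) -
      ((N.filter fun r => Survives c S ω r.1 ∧ Survives c S ω r.2).card : ℝ) -
      (Φ.filter (Survives c S ω)).card / (Q : ℝ) ^ 2) := by
    rw [Finset.sum_sub_distrib, Finset.sum_sub_distrib,
      ← Finset.sum_div Finset.univ (fun ω => ((Φ.filter (Survives c S ω)).card : ℝ)), hone A hA,
      hone Φ subset_rfl, Finset.sum_const, nsmul_eq_mul, Finset.card_univ, ← hW]
    have e1 : (N.card : ℝ) * (S.card * W / M ^ 3) ≤ A.card * (S.card * W / M ^ 2) / 4 := by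
      calc (N.card : ℝ) * (S.card * W / M ^ 3) ≤ (M / 4 * A.card) * (S.card * W / M ^ 3) := by
            gcongr
            nlinarith [Nat.cast_nonneg (α := ℝ) A.card]
        _ = _ := by field_simp
    have e2 : (Φ.card : ℝ) * (S.card * W / M ^ 2) / Q ^ 2 ≤ A.card * (S.card * W / M ^ 2) / 4 := by
      rw [div_le_iff₀ (by positivity)]
      calc (Φ.card : ℝ) * (S.card * W / M ^ 2) ≤ (A.card * Q ^ 2 / 4) * (S.card * W / M ^ 2) := by
            gcongr
            linarith
        _ = _ := by ring
    have e3 : W * ((A.card * S.card : ℝ) / (2 * M ^ 2)) = A.card * (S.card * W / M ^ 2) / 2 := by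
      field_simp
    linarith
  obtain ⟨ω, -, h⟩ := Finset.exists_le_of_sum_le Finset.univ_nonempty hsum
  exact ⟨ω, h⟩

theorem card_mul_le_of_sub_div {g q d e f a n r : ℝ} (hq : 0 < q)
    (h1 : g * q ^ 2 ≤ d * q ^ 3 + e) (h2 : e ≤ f) (h3 : a ≤ g + n)
    (h : r ≤ a - n - f / q ^ 2) : r ≤ q * d := by
  have h5 : r ≤ g - f / q ^ 2 := by linarith
  have h6 : g - f / q ^ 2 ≤ q * d := by
    rw [sub_le_iff_le_add, ← mul_le_mul_iff_left₀ (pow_pos hq 2)]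
    calc g * q ^ 2 ≤ d * q ^ 3 + f := by linarith
      _ = (q * d + f / q ^ 2) * q ^ 2 := by field_simp
  exact h5.trans h6

open Classical in
/-- Hashing into a set without three-term progressions isolates triples of `A` from each other
as soon as the modulus exceeds a multiple of the degree `R` in `A`; the remaining
triples of `Φ` are then destroyed by passing to an independent set. -/
theorem exists_inducedMatching (hM : M ≠ 2) {c : ι → ZMod M} {S : Finset (ZMod M)}
    (hS : ThreeAPFree (S : Set (ZMod M)))
    (Φ A : Finset ((ι → ZMod M) × (ι → ZMod M) × (ι → ZMod M)))
    (hΦ : ∀ p ∈ Φ, p.1 + p.2.1 + p.2.2 = c) (hA : A ⊆ Φ) (R : ℕ)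
    (hX : ∀ x, (A.filter fun p => p.1 = x).card ≤ R)
    (hY : ∀ y, (A.filter fun p => p.2.1 = y).card ≤ R)
    (hZ : ∀ z, (A.filter fun p => p.2.2 = z).card ≤ R)
    (hR : 12 * R ≤ M) (Q : ℕ) (hQ : 0 < Q) (hQ' : 4 * Φ.card ≤ A.card * Q ^ 2) :
    ∃ D ⊆ A, IsInducedMatching D Φ ∧
      (A.card * S.card : ℝ) ≤ 2 * M ^ 2 * Q * D.card := by
  obtain ⟨ω, hω⟩ := exists_good_hash hM hS Φ A hΦ hA R hX hY hZ hR Q hQ hQ'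
  set N := (A ×ˢ A).filter fun r => r.1 ≠ r.2 ∧ Meets r.1 r.2 with hN
  set N' := N.filter fun r => Survives c S ω r.1 ∧ Survives c S ω r.2 with hN'
  set A' := A.filter (Survives c S ω) with hA'
  set Φ' := Φ.filter (Survives c S ω) with hΦ'
  set G := A'.filter fun p => ∀ q ∈ A', Meets p q → p = q with hG
  have hGA : G ⊆ A := (Finset.filter_subset _ _).trans (Finset.filter_subset _ _)
  have hGmem : ∀ {p q}, p ∈ G → q ∈ G → Meets p q → p = q := fun hp hq h =>
    (Finset.mem_filter.1 hp).2 _ (Finset.mem_filter.1 hq).1 h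
  have hGsurv : ∀ {p}, p ∈ G → Survives c S ω p := fun hp =>
    (Finset.mem_filter.1 (Finset.mem_filter.1 hp).1).2
  have hcard : A'.card ≤ G.card + N'.card := by
    have hsub : A' ⊆ G ∪ N'.image Prod.fst := by
      intro p hp
      by_cases h : p ∈ G
      · exact Finset.mem_union_left _ h
      · refine Finset.mem_union_right _ ?_
        simp only [hG, Finset.mem_filter, hp, true_and, not_forall] at h
        obtain ⟨q, hq, hm, hne⟩ := h
        refine Finset.mem_image.2 ⟨(p, q), ?_, rfl⟩
        simp only [hN', hN, Finset.mem_filter, Finset.mem_product]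
        rw [hA', Finset.mem_filter] at hp hq
        exact ⟨⟨⟨hp.1, hq.1⟩, hne, hm⟩, hp.2, hq.2⟩
    exact (Finset.card_le_card hsub).trans ((Finset.card_union_le _ _).trans
      (Nat.add_le_add_left Finset.card_image_le _))
  let E := (G ×ˢ G ×ˢ G).filter fun e => (e.1 ≠ e.2.1 ∧ e.1 ≠ e.2.2 ∧ e.2.1 ≠ e.2.2) ∧
    (e.1.1, e.2.1.2.1, e.2.2.2.2) ∈ Φ
  have hEcard : E.card ≤ Φ'.card := by
    refine Finset.card_le_card_of_injOn (fun e => (e.1.1, e.2.1.2.1, e.2.2.2.2)) ?_ ?_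
    · intro e he
      simp only [E, Finset.coe_filter, Finset.mem_product, Set.mem_ofPred_eq] at he
      simp only [hΦ', Finset.coe_filter, Set.mem_ofPred_eq]
      exact ⟨he.2.2, (hGsurv he.1.1).1, (hGsurv he.1.2.1).2.1, (hGsurv he.1.2.2).2.2⟩
    · intro e he e' he' h
      simp only [E, Finset.coe_filter, Finset.mem_product, Set.mem_ofPred_eq] at he he'
      simp only [Prod.mk.injEq] at h
      exact Prod.ext (hGmem he.1.1 he'.1.1 (Or.inl h.1)) (Prod.ext
        (hGmem he.1.2.1 he'.1.2.1 (Or.inr (Or.inl h.2.1)))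
        (hGmem he.1.2.2 he'.1.2.2 (Or.inr (Or.inr h.2.2))))
  obtain ⟨D, hDG, hD, hDcard⟩ := exists_independent_set G E
    (fun e he => (Finset.mem_filter.1 he).2.1) Q hQ
  refine ⟨D, hDG.trans hGA, ?_, ?_⟩
  · intro p hp d₁ h₁ d₂ h₂ d₃ h₃ e₁ e₂ e₃
    have hps := hΦ p hp
    -- a triple of `Φ` sharing two coordinates with a triple `d` of `Φ` is equal to `d`
    by_cases h12 : d₁ = d₂
    · subst h12
      refine ⟨rfl, hGmem (hDG h₁) (hDG h₃) (Or.inr (Or.inr ?_))⟩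
      have h := hΦ _ (hA (hGA (hDG h₁)))
      rw [← e₁, ← e₂, ← hps] at h
      exact (add_left_cancel h).trans e₃
    by_cases h13 : d₁ = d₃
    · subst h13
      refine ⟨hGmem (hDG h₁) (hDG h₂) (Or.inr (Or.inl ?_)), rfl⟩
      have h := hΦ _ (hA (hGA (hDG h₁)))
      rw [← e₁, ← e₃, ← hps] at h
      exact (add_left_cancel (add_right_cancel h)).trans e₂
    by_cases h23 : d₂ = d₃
    · subst h23
      have h := hΦ _ (hA (hGA (hDG h₂)))
      rw [← e₂, ← e₃, ← hps] at h
      have := hGmem (hDG h₁) (hDG h₂) (Or.inl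
        (e₁.symm.trans (add_right_cancel (add_right_cancel h)).symm))
      exact ⟨this, this⟩
    · refine absurd ⟨h₁, h₂, h₃⟩ (hD (d₁, d₂, d₃) ?_)
      simp only [E, Finset.mem_filter, Finset.mem_product]
      refine ⟨⟨hDG h₁, hDG h₂, hDG h₃⟩, ⟨h12, h13, h23⟩, ?_⟩
      rw [← e₁, ← e₂, ← e₃]
      exact hp
  · have hQ0 : (0 : ℝ) < Q := by exact_mod_cast hQ
    have hM0 : (0 : ℝ) < M := by exact_mod_cast (Fact.out : M.Prime).pos
    have h1 : (G.card : ℝ) * Q ^ 2 ≤ D.card * Q ^ 3 + E.card := by exact_mod_cast hDcard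
    have h2 : (E.card : ℝ) ≤ Φ'.card := by exact_mod_cast hEcard
    have h3 : (A'.card : ℝ) ≤ G.card + N'.card := by exact_mod_cast hcard
    have h4 := card_mul_le_of_sub_div hQ0 h1 h2 h3 hω
    rw [div_le_iff₀ (by positivity)] at h4
    linarith

end Matching

/-! ### Progression-free sets modulo a prime -/

/-- Behrend's set, placed in the lower half of the residues so that no progression wraps around. -/
theorem exists_threeAPFree_zmod {M : ℕ} [Fact M.Prime] (hM : M ≠ 2) :
    ∃ S : Finset (ZMod M), ThreeAPFree (S : Set (ZMod M)) ∧
      (M : ℝ) / 3 * Real.exp (-4 * √(Real.log M)) ≤ S.card := by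
  have hp : M.Prime := Fact.out
  have hodd : M % 2 = 1 := hp.eq_two_or_odd.resolve_left hM
  have h3 : 3 ≤ M := by have := hp.two_le; omega
  obtain ⟨n, rfl⟩ : ∃ n, M = n + 1 := ⟨M - 1, by omega⟩
  let k : Fin (n + 1) := ⟨n / 2, by omega⟩
  obtain ⟨t, -, ht, hfree⟩ := addRothNumber_spec (Finset.Iio k)
  refine ⟨t, hfree, ?_⟩
  have hcard : t.card = rothNumberNat k := by
    rw [ht, Fin.addRothNumber_eq_rothNumberNat (by simp only [k]; omega)]
  refine le_trans ?_ (Behrend.roth_lower_bound.trans (Nat.cast_le.2 hcard.ge))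
  have h1 : (((n + 1 : ℕ) : ℝ)) / 3 ≤ ((k : ℕ) : ℝ) := by
    rw [div_le_iff₀ (by norm_num)]
    have : n + 1 ≤ n / 2 * 3 := by omega
    simp only [k]
    exact_mod_cast this
  have hk : (0 : ℝ) < ((k : ℕ) : ℝ) := lt_of_lt_of_le (by positivity) h1
  have h2 : Real.log ((k : ℕ) : ℝ) ≤ Real.log ((n + 1 : ℕ) : ℝ) := by
    refine Real.log_le_log hk ?_
    simp only [k]
    exact_mod_cast (by omega : n / 2 ≤ n + 1)
  have h4 := Real.sqrt_le_sqrt h2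
  gcongr ?_ * Real.exp ?_
  linarith

/-! ### Types of sequences and entropy -/

section Types

variable {A : Type*} {n : ℕ}

/-- The number of occurrences of a letter in a sequence. -/
def letterCount [DecidableEq A] {n : ℕ} (f : Fin n → A) (s : A) : ℕ := (Finset.univ.filter fun l => f l = s).card

/-- The Shannon entropy, in natural units. -/
noncomputable def entropy [Fintype A] (α : A → ℝ) : ℝ := ∑ s, Real.negMulLog (α s)

/-- The marginal of `α` along `g`. -/
def marginal [Fintype A] {B : Type*} [DecidableEq B] (g : A → B) (α : A → ℝ) (b : B) : ℝ :=
  ∑ s, if g s = b then α s else 0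

/-- The probability of a sequence depends only on its type. -/
theorem prod_comp_eq_prod_pow [Fintype A] [DecidableEq A] {R : Type*} [CommMonoid R] (f : Fin n → A) (w : A → R) :
    ∏ l, w (f l) = ∏ s, w s ^ letterCount f s := by
  rw [← Finset.prod_fiberwise' Finset.univ f w]
  simp [letterCount]

theorem letterCount_comp [Fintype A] [DecidableEq A] {B : Type*} [DecidableEq B] (f : Fin n → A) (g : A → B) (b : B) :
    letterCount (g ∘ f) b = ∑ s, if g s = b then letterCount f s else 0 := by
  simp only [letterCount]
  rw [Finset.card_eq_sum_card_fiberwise (f := f) (t := Finset.univ) (fun _ _ => by simp)]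
  refine Finset.sum_congr rfl fun s _ => ?_
  rw [Finset.filter_filter]
  split_ifs with h
  · congr 1
    ext l
    simp only [Finset.mem_filter, Finset.mem_univ, true_and, Function.comp_apply]
    exact ⟨fun h' => h'.2, fun h' => ⟨by rw [h', h], h'⟩⟩
  · rw [Finset.card_eq_zero, Finset.filter_eq_empty_iff]
    rintro l - ⟨h1, h2⟩
    exact h (by rw [← h2]; exact h1)

theorem sum_letterCount [Fintype A] [DecidableEq A] (f : Fin n → A) : ∑ s, letterCount f s = n := by
  simp only [letterCount]
  rw [← Finset.card_eq_sum_card_fiberwise (f := f) (t := Finset.univ) (fun _ _ => by simp)]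
  simp

theorem letterCount_le [DecidableEq A] (f : Fin n → A) (s : A) : letterCount f s ≤ n := by
  simpa [letterCount] using Finset.card_filter_le Finset.univ fun l => f l = s

theorem letterCount_pos [DecidableEq A] (f : Fin n → A) (l : Fin n) : 0 < letterCount f (f l) :=
  Finset.card_pos.2 ⟨l, by simp⟩

theorem sum_prod_eq_one [Fintype A] {α : A → ℝ} (h1 : ∑ s, α s = 1) (n : ℕ) :
    ∑ f : Fin n → A, ∏ l, α (f l) = 1 := by
  rw [← Fintype.prod_sum fun _ => α]
  simp [h1]

theorem sum_fin_succ_arrow [Fintype A] (n : ℕ) (w : (Fin (n + 1) → A) → ℝ) :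
    ∑ f, w f = ∑ s, ∑ f : Fin n → A, w (Fin.cons s f) := by
  rw [← (Fin.consEquiv fun _ : Fin (n + 1) => A).sum_comp, Fintype.sum_prod_type]
  rfl

/-- The first and second moments of a sum of independent centred variables. -/
theorem sum_prod_mul_sum_sq [Fintype A] {α g : A → ℝ} (h1 : ∑ s, α s = 1) (hg : ∑ s, α s * g s = 0) (n : ℕ) :
    ∑ f : Fin n → A, (∏ l, α (f l)) * (∑ l, g (f l)) = 0 ∧
    ∑ f : Fin n → A, (∏ l, α (f l)) * (∑ l, g (f l)) ^ 2 = n * ∑ s, α s * g s ^ 2 := by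
  induction n with
  | zero => simp
  | succ n ih =>
    have h0 := sum_prod_eq_one h1 n
    constructor
    · rw [sum_fin_succ_arrow]
      simp only [Fin.prod_univ_succ, Fin.sum_univ_succ, Fin.cons_zero, Fin.cons_succ]
      have : ∀ s, ∑ f : Fin n → A, α s * (∏ l, α (f l)) * (g s + ∑ l, g (f l)) = α s * g s := by
        intro s
        have e : ∀ f : Fin n → A, α s * (∏ l, α (f l)) * (g s + ∑ l, g (f l)) =
            α s * g s * (∏ l, α (f l)) + α s * ((∏ l, α (f l)) * ∑ l, g (f l)) := fun f => by ring
        simp only [e, Finset.sum_add_distrib, ← Finset.mul_sum, h0, ih.1]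
        ring
      simp only [this, hg]
    · rw [sum_fin_succ_arrow]
      simp only [Fin.prod_univ_succ, Fin.sum_univ_succ, Fin.cons_zero, Fin.cons_succ]
      have : ∀ s, ∑ f : Fin n → A, α s * (∏ l, α (f l)) * (g s + ∑ l, g (f l)) ^ 2 =
          α s * g s ^ 2 + α s * (n * ∑ s, α s * g s ^ 2) := by
        intro s
        have e : ∀ f : Fin n → A, α s * (∏ l, α (f l)) * (g s + ∑ l, g (f l)) ^ 2 =
            α s * g s ^ 2 * (∏ l, α (f l)) + 2 * α s * g s * ((∏ l, α (f l)) * ∑ l, g (f l)) +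
            α s * ((∏ l, α (f l)) * (∑ l, g (f l)) ^ 2) := fun f => by ring
        simp only [e, Finset.sum_add_distrib, ← Finset.mul_sum, h0, ih.1, ih.2]
        ring
      simp only [this, Finset.sum_add_distrib, ← Finset.sum_mul, h1]
      push_cast
      ring

theorem sum_prod_mul_letterCount_sub_sq_le [Fintype A] [DecidableEq A] {α : A → ℝ} (h0 : ∀ s, 0 ≤ α s) (h1 : ∑ s, α s = 1)
    (n : ℕ) (s : A) :
    ∑ f : Fin n → A, (∏ l, α (f l)) * (letterCount f s - n * α s) ^ 2 ≤ n := by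
  have hle : α s ≤ 1 := h1 ▸ Finset.single_le_sum (fun i _ => h0 i) (Finset.mem_univ s)
  have hg : ∑ r, α r * ((if r = s then 1 else 0) - α s) = 0 := by
    simp only [mul_sub, Finset.sum_sub_distrib, ← Finset.sum_mul, h1]
    simp
  have key := (sum_prod_mul_sum_sq h1 hg n).2
  have e : ∀ f : Fin n → A, ∑ l, ((if f l = s then (1 : ℝ) else 0) - α s) =
      letterCount f s - n * α s := by
    intro f
    simp [letterCount, Finset.sum_sub_distrib]
  simp only [e] at key
  rw [key]
  have hv : ∑ r, α r * ((if r = s then 1 else 0) - α s) ^ 2 ≤ 1 := by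
    rw [← h1]
    refine Finset.sum_le_sum fun r _ => ?_
    refine mul_le_of_le_one_right (h0 r) ?_
    split_ifs <;> nlinarith [h0 s]
  nlinarith [Nat.cast_nonneg (α := ℝ) n]

/-- Chebyshev's inequality and the pigeonhole principle: some type close to `α` carries a
polynomial share of the probability. -/
theorem exists_typical_type [Fintype A] [DecidableEq A] {α : A → ℝ} (h0 : ∀ s, 0 ≤ α s) (h1 : ∑ s, α s = 1) {ε : ℝ}
    (hε : 0 < ε) (hn : 2 * Fintype.card A ≤ ε ^ 2 * n) :
    ∃ t : A → ℕ, (∀ s, |(t s : ℝ) - n * α s| ≤ ε * n) ∧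
      1 / (2 * ((n : ℝ) + 1) ^ Fintype.card A) ≤
        ∑ f : Fin n → A with letterCount f = t, ∏ l, α (f l) := by
  have hA : 0 < Fintype.card A := by
    rw [Fintype.card_pos_iff]
    by_contra h
    rw [not_nonempty_iff] at h
    simp at h1
  have hn0 : (0 : ℝ) < n := by
    have : (0 : ℝ) < Fintype.card A := by exact_mod_cast hA
    by_contra h
    have : ε ^ 2 * n ≤ 0 := mul_nonpos_of_nonneg_of_nonpos (by positivity) (not_lt.1 h)
    linarith
  have hW : ∀ f : Fin n → A, 0 ≤ ∏ l, α (f l) := fun f => Finset.prod_nonneg fun l _ => h0 _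
  let good : (Fin n → A) → Prop := fun f => ∀ s, |(letterCount f s : ℝ) - n * α s| ≤ ε * n
  classical
  have hbad : ∑ f : Fin n → A with ¬ good f, ∏ l, α (f l) ≤ 1 / 2 := by
    have hs : ∀ f : Fin n → A, (if ¬ good f then ∏ l, α (f l) else 0) ≤
        ∑ s, (∏ l, α (f l)) * (letterCount f s - n * α s) ^ 2 / (ε * n) ^ 2 := by
      intro f
      have hnn : ∀ s, 0 ≤ (∏ l, α (f l)) * (letterCount f s - n * α s) ^ 2 / (ε * n) ^ 2 :=
        fun s => div_nonneg (mul_nonneg (hW f) (sq_nonneg _)) (sq_nonneg _)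
      split_ifs with h
      · exact Finset.sum_nonneg fun s _ => hnn s
      · simp only [good, not_forall, not_le] at h
        obtain ⟨s, hs⟩ := h
        refine le_trans ?_ (Finset.single_le_sum (fun s _ => hnn s) (Finset.mem_univ s))
        rw [le_div_iff₀ (by positivity)]
        refine mul_le_mul_of_nonneg_left ?_ (hW f)
        rw [← sq_abs ((letterCount f s : ℝ) - n * α s)]
        gcongr
    rw [Finset.sum_filter]
    calc _ ≤ _ := Finset.sum_le_sum fun f _ => hs f
      _ = ∑ s, (∑ f : Fin n → A, (∏ l, α (f l)) * (letterCount f s - n * α s) ^ 2) /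
            (ε * n) ^ 2 := by
          rw [Finset.sum_comm]
          simp only [Finset.sum_div]
      _ ≤ ∑ s : A, (n : ℝ) / (ε * n) ^ 2 := by
          refine Finset.sum_le_sum fun s _ => ?_
          gcongr
          exact sum_prod_mul_letterCount_sub_sq_le h0 h1 n s
      _ ≤ 1 / 2 := by
          rw [Finset.sum_const, nsmul_eq_mul, Finset.card_univ, ← mul_div_assoc,
            div_le_div_iff₀ (by positivity) (by norm_num)]
          nlinarith
  have hgood : 1 / 2 ≤ ∑ f : Fin n → A with good f, ∏ l, α (f l) := by
    have := Finset.sum_filter_add_sum_filter_not Finset.univ good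
      (fun f : Fin n → A => ∏ l, α (f l))
    rw [sum_prod_eq_one h1 n] at this
    linarith
  let ty : (Fin n → A) → (A → Fin (n + 1)) := fun f s =>
    ⟨letterCount f s, Nat.lt_succ_of_le (letterCount_le f s)⟩
  rw [← Finset.sum_fiberwise _ ty] at hgood
  obtain ⟨t, -, ht⟩ : ∃ t ∈ (Finset.univ : Finset (A → Fin (n + 1))),
      1 / (2 * ((n : ℝ) + 1) ^ Fintype.card A) ≤
        ∑ f ∈ Finset.univ.filter good with ty f = t, ∏ l, α (f l) := by
    refine Finset.exists_le_of_sum_le Finset.univ_nonempty (le_trans ?_ hgood)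
    rw [Finset.sum_const, nsmul_eq_mul, Finset.card_univ]
    simp only [Fintype.card_fun, Fintype.card_fin]
    push_cast
    field_simp
    rfl
  have hpos : (0 : ℝ) < 1 / (2 * ((n : ℝ) + 1) ^ Fintype.card A) := by positivity
  obtain ⟨f, hf⟩ : ((Finset.univ.filter good).filter fun f => ty f = t).Nonempty := by
    rw [Finset.nonempty_iff_ne_empty]
    intro h
    rw [h, Finset.sum_empty] at ht
    linarith
  simp only [Finset.mem_filter, Finset.mem_univ, true_and] at hf
  have hft : ∀ s, letterCount f s = t s := fun s => by rw [← hf.2]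
  refine ⟨fun s => t s, fun s => ?_, ht.trans ?_⟩
  · have := hf.1 s
    rwa [hft] at this
  · refine Finset.sum_le_sum_of_subset_of_nonneg ?_ fun f _ _ => hW f
    intro f' hf'
    simp only [Finset.mem_filter, Finset.mem_univ, true_and] at hf' ⊢
    funext s
    rw [← hf'.2]

/-- The sequences of type `t`. -/
def typeClass [Fintype A] [DecidableEq A] (n : ℕ) (t : A → ℕ) : Finset (Fin n → A) :=
  Finset.univ.filter fun f => letterCount f = t

theorem mem_typeClass [Fintype A] [DecidableEq A] {t : A → ℕ} {f : Fin n → A} : f ∈ typeClass n t ↔ letterCount f = t := by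
  simp [typeClass]

theorem sum_typeClass [Fintype A] [DecidableEq A] (α : A → ℝ) (t : A → ℕ) :
    ∑ f ∈ typeClass n t, ∏ l, α (f l) = (typeClass n t).card * ∏ s, α s ^ t s := by
  rw [← nsmul_eq_mul, ← Finset.sum_const]
  refine Finset.sum_congr rfl fun f hf => ?_
  rw [prod_comp_eq_prod_pow, mem_typeClass.1 hf]

/-- The number of sequences of type `t` is at most `exp (n H(t / n))`. -/
theorem card_typeClass_le [Fintype A] [DecidableEq A] (hn : 0 < n) (t : A → ℕ) :
    ((typeClass n t).card : ℝ) ≤ Real.exp (n * entropy fun s => (t s : ℝ) / n) := by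
  have hn0 : (0 : ℝ) < n := by exact_mod_cast hn
  by_cases ht : (typeClass n t).Nonempty
  · obtain ⟨f, hf⟩ := ht
    have h1 : ∑ s, ((t s : ℝ) / n) = 1 := by
      rw [← Finset.sum_div, ← Nat.cast_sum, ← mem_typeClass.1 hf, sum_letterCount,
        div_self hn0.ne']
    have h2 : ∏ s, ((t s : ℝ) / n) ^ t s = Real.exp (-(n * entropy fun s => (t s : ℝ) / n)) := by
      rw [entropy, Finset.mul_sum, ← Finset.sum_neg_distrib, Real.exp_sum]
      refine Finset.prod_congr rfl fun s _ => ?_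
      rcases Nat.eq_zero_or_pos (t s) with h | h
      · simp [h]
      · have h' : (0 : ℝ) < t s := by exact_mod_cast h
        have : -(n * Real.negMulLog ((t s : ℝ) / n)) = t s * Real.log ((t s : ℝ) / n) := by
          rw [Real.negMulLog]
          field_simp
        rw [this, Real.exp_nat_mul, Real.exp_log (by positivity)]
    have h3 : ∑ f ∈ typeClass n t, ∏ l, ((t (f l) : ℝ) / n) ≤ 1 := by
      rw [← sum_prod_eq_one h1 n]
      exact Finset.sum_le_sum_of_subset_of_nonneg (Finset.subset_univ _)
        fun f _ _ => Finset.prod_nonneg fun l _ => by positivity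
    rw [sum_typeClass (fun s => (t s : ℝ) / n), h2, Real.exp_neg, ← div_eq_mul_inv,
      div_le_one (Real.exp_pos _)] at h3
    exact h3
  · rw [Finset.not_nonempty_iff_eq_empty] at ht
    rw [ht]
    simpa using (Real.exp_pos _).le

/-- Sequences of type `t` with a given image under `g` are at most as many as the quotient of the
probability of the image by that of the sequence. -/
theorem card_typeClass_fiber_mul_le [Fintype A] [DecidableEq A] {B : Type*} [DecidableEq B] {α : A → ℝ} (h0 : ∀ s, 0 ≤ α s)
    (g : A → B) (t : A → ℕ) (u : Fin n → B) :
    (((typeClass n t).filter fun f => g ∘ f = u).card : ℝ) * ∏ s, α s ^ t s ≤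
      ∏ s, marginal g α (g s) ^ t s := by
  have hnn : ∀ b, 0 ≤ marginal g α b := fun b =>
    Finset.sum_nonneg fun r _ => by split_ifs; exacts [h0 r, le_rfl]
  by_cases hne : ((typeClass n t).filter fun f => g ∘ f = u).Nonempty
  · obtain ⟨f, hf⟩ := hne
    rw [Finset.mem_filter, mem_typeClass] at hf
    have h1 : ∏ s, marginal g α (g s) ^ t s =
        ∏ l, ∑ r, if g r = u l then α r else 0 := by
      rw [← hf.1, ← prod_comp_eq_prod_pow f (fun s => marginal g α (g s)), ← hf.2]
      rfl
    rw [h1, Fintype.prod_sum, ← nsmul_eq_mul, ← Finset.sum_const]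
    have h2 : ∀ f : Fin n → A, 0 ≤ ∏ l, if g (f l) = u l then α (f l) else 0 := fun f =>
      Finset.prod_nonneg fun l _ => by split_ifs; exacts [h0 _, le_rfl]
    refine le_trans (Finset.sum_le_sum fun f' hf' => le_of_eq ?_)
      (Finset.sum_le_sum_of_subset_of_nonneg (Finset.subset_univ _) fun f _ _ => h2 f)
    rw [Finset.mem_filter, mem_typeClass] at hf'
    rw [← hf'.1, ← prod_comp_eq_prod_pow f' α, ← hf'.2]
    simp
  · rw [Finset.not_nonempty_iff_eq_empty] at hne
    rw [hne]
    simpa using Finset.prod_nonneg fun s _ => pow_nonneg (hnn _) _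

/-- A product of powers with exponents close to `n α` is close to the exponential of `n` times the
`α`-average of the logarithms. -/
theorem log_prod_pow_le [Fintype A] {α w : A → ℝ} {t : A → ℕ} {ε : ℝ}
    (ht : ∀ s, |(t s : ℝ) - n * α s| ≤ ε * n) (hw : ∀ s, t s ≠ 0 → w s ≠ 0) :
    Real.log (∏ s, w s ^ t s) ≤
      n * ∑ s, α s * Real.log (w s) + ε * n * ∑ s, |Real.log (w s)| := by
  rw [Real.log_prod fun s _ => ?_, Finset.mul_sum, Finset.mul_sum, ← Finset.sum_add_distrib]
  · refine Finset.sum_le_sum fun s _ => ?_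
    rw [Real.log_pow]
    have h1 : ((t s : ℝ) - n * α s) * Real.log (w s) ≤ ε * n * |Real.log (w s)| :=
      (le_abs_self _).trans (by rw [abs_mul]; gcongr; exact ht s)
    linarith
  · by_cases h : t s = 0
    · simp [h]
    · exact pow_ne_zero _ (hw s h)

theorem sum_mul_log_marginal [Fintype A] {B : Type*} [Fintype B] [DecidableEq B] (α : A → ℝ) (g : A → B) :
    ∑ s, α s * Real.log (marginal g α (g s)) = -entropy (marginal g α) := by
  rw [entropy, ← Finset.sum_neg_distrib, ← Finset.sum_fiberwise Finset.univ g]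
  refine Finset.sum_congr rfl fun b _ => ?_
  rw [Finset.sum_filter, Real.negMulLog]
  rw [neg_mul, neg_neg, marginal, Finset.sum_mul]
  change _ = ∑ i, (if g i = b then α i else 0) * Real.log (marginal g α b)
  refine Finset.sum_congr rfl fun s _ => ?_
  split_ifs with h
  · rw [h]
  · simp

theorem sum_mul_log_self [Fintype A] (α : A → ℝ) : ∑ s, α s * Real.log (α s) = -entropy α := by
  rw [entropy, ← Finset.sum_neg_distrib]
  exact Finset.sum_congr rfl fun s _ => by rw [Real.negMulLog]; ring

theorem continuous_entropy [Fintype A] : Continuous (entropy : (A → ℝ) → ℝ) := by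
  unfold entropy
  fun_prop

end Types

/-! ### Induced matchings among triples of block sequences -/

section BlockSequences

variable {kX kY kZ n : ℕ}

/-- Three sequences of block indices: they index a block of `(T ⊗ T^r ⊗ T^rr)^{⊗ n}`. -/
abbrev BlockTriple (kX kY kZ n : ℕ) :=
  (Fin n → Fin kX × Fin kY × Fin kZ) × (Fin n → Fin kX × Fin kY × Fin kZ) ×
    (Fin n → Fin kX × Fin kY × Fin kZ)

/-- The part of the first variable set that belongs to a block. -/
def labelX (d : BlockTriple kX kY kZ n) : (Fin n → Fin kX) × (Fin n → Fin kY) × (Fin n → Fin kZ) :=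
  (fun l => (d.1 l).1, fun l => (d.2.1 l).2.1, fun l => (d.2.2 l).2.2)

/-- The part of the second variable set that belongs to a block. -/
def labelY (d : BlockTriple kX kY kZ n) : (Fin n → Fin kY) × (Fin n → Fin kZ) × (Fin n → Fin kX) :=
  (fun l => (d.1 l).2.1, fun l => (d.2.1 l).2.2, fun l => (d.2.2 l).1)

/-- The part of the third variable set that belongs to a block. -/
def labelZ (d : BlockTriple kX kY kZ n) : (Fin n → Fin kZ) × (Fin n → Fin kX) × (Fin n → Fin kY) :=
  (fun l => (d.1 l).2.2, fun l => (d.2.1 l).1, fun l => (d.2.2 l).2.1)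

/-- The coordinates of a label modulo `M`. -/
def labelCode (M : ℕ) {a b c : ℕ} (u : (Fin n → Fin a) × (Fin n → Fin b) × (Fin n → Fin c)) :
    Fin n ⊕ Fin n ⊕ Fin n → ZMod M :=
  Sum.elim (fun l => ((u.1 l : ℕ) : ZMod M))
    (Sum.elim (fun l => ((u.2.1 l : ℕ) : ZMod M)) (fun l => ((u.2.2 l : ℕ) : ZMod M)))

theorem fin_val_injective_zmod {M a : ℕ} (ha : a ≤ M) {i j : Fin a}
    (h : ((i : ℕ) : ZMod M) = ((j : ℕ) : ZMod M)) : i = j := by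
  rw [ZMod.natCast_eq_natCast_iff'] at h
  rw [Nat.mod_eq_of_lt (i.2.trans_le ha), Nat.mod_eq_of_lt (j.2.trans_le ha)] at h
  exact Fin.ext h

theorem labelCode_injective {M a b c : ℕ} (ha : a ≤ M) (hb : b ≤ M) (hc : c ≤ M) :
    Function.Injective (labelCode M :
      (Fin n → Fin a) × (Fin n → Fin b) × (Fin n → Fin c) → _) := by
  intro u v h
  refine Prod.ext (funext fun l => ?_) (Prod.ext (funext fun l => ?_) (funext fun l => ?_))
  · exact fin_val_injective_zmod ha (congrFun h (Sum.inl l))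
  · exact fin_val_injective_zmod hb (congrFun h (Sum.inr (Sum.inl l)))
  · exact fin_val_injective_zmod hc (congrFun h (Sum.inr (Sum.inr l)))

theorem blockTriple_ext {d e : BlockTriple kX kY kZ n} (hX : labelX d = labelX e)
    (hY : labelY d = labelY e) (hZ : labelZ d = labelZ e) : d = e := by
  simp only [labelX, labelY, labelZ, Prod.mk.injEq, funext_iff] at hX hY hZ
  refine Prod.ext (funext fun l => ?_) (Prod.ext (funext fun l => ?_) (funext fun l => ?_))
  · exact Prod.ext (hX.1 l) (Prod.ext (hY.1 l) (hZ.1 l))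
  · exact Prod.ext (hZ.2.1 l) (Prod.ext (hX.2.1 l) (hY.2.1 l))
  · exact Prod.ext (hY.2.2 l) (Prod.ext (hZ.2.2 l) (hX.2.2 l))

/-- The three labels of a block, as vectors modulo `M`. -/
def tripleCode (M : ℕ) (d : BlockTriple kX kY kZ n) :
    (Fin n ⊕ Fin n ⊕ Fin n → ZMod M) × (Fin n ⊕ Fin n ⊕ Fin n → ZMod M) ×
      (Fin n ⊕ Fin n ⊕ Fin n → ZMod M) :=
  (labelCode M (labelX d), labelCode M (labelY d), labelCode M (labelZ d))

theorem tripleCode_sum (M : ℕ) {P : ℤ} {S : Finset (Fin kX × Fin kY × Fin kZ)}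
    (hS : ∀ s ∈ S,
      ((s.1 : ℕ) + 1 : ℤ) + ((s.2.1 : ℕ) + 1 : ℤ) + ((s.2.2 : ℕ) + 1 : ℤ) = P)
    {d : BlockTriple kX kY kZ n} (hd : ∀ l, d.1 l ∈ S ∧ d.2.1 l ∈ S ∧ d.2.2 l ∈ S) :
    (tripleCode M d).1 + (tripleCode M d).2.1 + (tripleCode M d).2.2 =
      fun _ => ((P - 3 : ℤ) : ZMod M) := by
  have key : ∀ s ∈ S, ((s.1 : ℕ) : ZMod M) + ((s.2.1 : ℕ) : ZMod M) + ((s.2.2 : ℕ) : ZMod M) =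
      ((P - 3 : ℤ) : ZMod M) := by
    intro s hs
    rw [← hS s hs]
    push_cast
    ring
  funext l
  rcases l with l | l | l
  · exact key _ (hd l).1
  · refine Eq.trans ?_ (key _ (hd l).2.1)
    simp only [tripleCode, labelCode, labelX, labelY, labelZ, Pi.add_apply, Sum.elim_inr,
      Sum.elim_inl]
    ring
  · refine Eq.trans ?_ (key _ (hd l).2.2)
    simp only [tripleCode, labelCode, labelX, labelY, labelZ, Pi.add_apply, Sum.elim_inr]
    ring

/-- Every fibre of `p` on `A` has at most `a` elements. Quantifying over the subsets of a fibre
avoids decidability assumptions. -/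
def FiberBound {W L : Type*} (A : Finset W) (p : W → L) (a : ℕ) : Prop :=
  ∀ u, ∀ s ⊆ A, (∀ d ∈ s, p d = u) → s.card ≤ a

theorem FiberBound.card_filter_le {W L : Type*} {A : Finset W} {p : W → L} {a : ℕ}
    (h : FiberBound A p a) (u : L) [DecidablePred fun d => p d = u] :
    (A.filter fun d => p d = u).card ≤ a :=
  h u _ (Finset.filter_subset _ _) fun _ hd => (Finset.mem_filter.1 hd).2

theorem FiberBound.pos {W L : Type*} {A : Finset W} {p : W → L} {a : ℕ}
    (h : FiberBound A p a) (hA : A.Nonempty) : 0 < a := by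
  obtain ⟨d, hd⟩ := hA
  have := h (p d) {d} (Finset.singleton_subset_iff.2 hd) (by simp)
  rw [Finset.card_singleton] at this
  exact this

theorem FiberBound.prod {A B C W : Type*} {A₀ : Finset W} {p : W → A} {q : W → B} {r : W → C}
    {a b c : ℕ} (ha : FiberBound A₀ p a) (hb : FiberBound A₀ q b) (hc : FiberBound A₀ r c) :
    FiberBound (A₀ ×ˢ A₀ ×ˢ A₀) (fun d => (p d.1, q d.2.1, r d.2.2)) (a * b * c) := by
  classical
  intro u s hs hu
  have hsub : s ⊆ (A₀.filter fun f => p f = u.1) ×ˢ (A₀.filter fun f => q f = u.2.1) ×ˢ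
        (A₀.filter fun f => r f = u.2.2) := by
    intro d hd
    have h1 := hs hd
    obtain rfl := hu d hd
    simp only [Finset.mem_filter, Finset.mem_product] at h1 ⊢
    exact ⟨⟨h1.1, trivial⟩, ⟨h1.2.1, trivial⟩, ⟨h1.2.2, trivial⟩⟩
  refine (Finset.card_le_card hsub).trans ?_
  rw [Finset.card_product, Finset.card_product, mul_assoc]
  exact Nat.mul_le_mul (ha.card_filter_le _) (Nat.mul_le_mul (hb.card_filter_le _)
    (hc.card_filter_le _))

theorem FiberBound.image {W L U V : Type*} [DecidableEq V] {A : Finset W} {code : W → V}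
    {π : V → U} {lab : W → L} {enc : L → U} {R : ℕ} (hR : FiberBound A lab R)
    (henc : Function.Injective enc) (h : ∀ d, π (code d) = enc (lab d)) :
    FiberBound (A.image code) π R := by
  intro x s hs hx
  rcases s.eq_empty_or_nonempty with rfl | ⟨p₀, hp₀⟩
  · simp
  obtain ⟨d₀, -, rfl⟩ := Finset.mem_image.1 (hs hp₀)
  have hle : s ⊆ (A.filter fun d => code d ∈ s).image code := by
    intro p hp
    obtain ⟨d, hd, rfl⟩ := Finset.mem_image.1 (hs hp)
    exact Finset.mem_image_of_mem _ (Finset.mem_filter.2 ⟨hd, hp⟩)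
  refine (Finset.card_le_card hle).trans (Finset.card_image_le.trans ?_)
  refine hR (lab d₀) _ (Finset.filter_subset _ _) fun d hd => henc ?_
  rw [← h, ← h, hx _ hp₀, hx _ (Finset.mem_filter.1 hd).2]

/-- A number of colours whose square is of order `x`. -/
theorem exists_nat_sq_ge {x : ℝ} (hx : 1 ≤ x) :
    ∃ Q : ℕ, 0 < Q ∧ 4 * x ≤ (Q : ℝ) ^ 2 ∧ Real.log Q ≤ Real.log 3 + Real.log x / 2 := by
  have h1 : 1 ≤ √x := Real.one_le_sqrt.2 hx
  have h2 := Nat.le_ceil (2 * √x)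
  have h3 := Nat.ceil_lt_add_one (show 0 ≤ 2 * √x by positivity)
  have h4 : (0 : ℝ) < ⌈2 * √x⌉₊ := lt_of_lt_of_le (by positivity) h2
  refine ⟨⌈2 * √x⌉₊, by exact_mod_cast h4, ?_, ?_⟩
  · calc 4 * x = (2 * √x) ^ 2 := by rw [mul_pow, Real.sq_sqrt (by linarith)]; norm_num
      _ ≤ _ := by gcongr
  · rw [← Real.log_sqrt (by linarith), ← Real.log_mul (by norm_num) (by positivity)]
    exact Real.log_le_log h4 (by linarith)

/-- The logarithmic form of the bound `A ^ 3 * S ≤ 2 * M ^ 2 * Q * D` for the size `D` of an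
induced matching, with the sizes of the modulus `M`, the progression-free set `S` and the number of
colours `Q` inserted. -/
theorem log_matching_ge {κ a b c A F S M Q D : ℝ} (hκ : 0 < κ) (ha : 0 < a) (hb : 0 < b)
    (hc : 0 < c) (hA : 0 < A) (hF : 0 < F) (hM : 0 < M) (hQ : 0 < Q) (hD : 0 < D)
    (hMR : M ≤ κ * (a * b * c)) (hS : M / 3 * Real.exp (-4 * √(Real.log M)) ≤ S)
    (hAS : A ^ 3 * S ≤ 2 * M ^ 2 * Q * D)
    (hQlog : Real.log Q ≤ Real.log 3 + Real.log ((F / A) ^ 3) / 2) :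
    3 * Real.log A - Real.log a - Real.log b - Real.log c -
        3 / 2 * (Real.log F - Real.log A) - Real.log 18 - Real.log κ -
        4 * √(Real.log κ + Real.log a + Real.log b + Real.log c) ≤ Real.log D := by
  have hS0 : 0 < S := lt_of_lt_of_le (by positivity) hS
  have logM : Real.log M ≤ Real.log κ + Real.log a + Real.log b + Real.log c := by
    rw [← Real.log_mul hκ.ne' ha.ne', ← Real.log_mul (by positivity) hb.ne',
      ← Real.log_mul (by positivity) hc.ne']
    exact Real.log_le_log hM (by linarith)
  have logS : Real.log M - Real.log 3 - 4 * √(Real.log M) ≤ Real.log S := by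
    have h := Real.log_le_log (by positivity) hS
    rw [Real.log_mul (by positivity) (Real.exp_pos _).ne', Real.log_exp,
      Real.log_div hM.ne' (by norm_num)] at h
    linarith
  have hmain : 3 * Real.log A + Real.log S ≤
      Real.log 2 + 2 * Real.log M + Real.log Q + Real.log D := by
    have h := Real.log_le_log (by positivity) hAS
    rw [Real.log_mul (by positivity) hS0.ne', Real.log_mul (by positivity) hD.ne',
      Real.log_mul (by positivity) hQ.ne', Real.log_mul (by positivity) (by positivity),
      Real.log_pow, Real.log_pow] at h
    push_cast at h
    linarith
  rw [Real.log_pow, Real.log_div hF.ne' hA.ne'] at hQlog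
  push_cast at hQlog
  have hsqrt := Real.sqrt_le_sqrt logM
  have h18 : Real.log 18 = Real.log 2 + Real.log 3 + Real.log 3 := by
    rw [← Real.log_mul (by norm_num) (by norm_num), ← Real.log_mul (by norm_num) (by norm_num)]
    norm_num
  linarith

/-- The size of the induced matching, up to the subexponential loss from hashing. -/
theorem exists_blockTriple_matching {P : ℤ} {S : Finset (Fin kX × Fin kY × Fin kZ)}
    (hS : ∀ s ∈ S,
      ((s.1 : ℕ) + 1 : ℤ) + ((s.2.1 : ℕ) + 1 : ℤ) + ((s.2.2 : ℕ) + 1 : ℤ) = P)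
    (A₀ Φ₀ : Finset (Fin n → Fin kX × Fin kY × Fin kZ)) (hA₀ : A₀.Nonempty) (hsub : A₀ ⊆ Φ₀)
    (hΦ₀ : ∀ f ∈ Φ₀, ∀ l, f l ∈ S) {a b c : ℕ}
    (ha : FiberBound A₀ (fun f l => (f l).1) a) (hb : FiberBound A₀ (fun f l => (f l).2.1) b)
    (hc : FiberBound A₀ (fun f l => (f l).2.2) c) :
    ∃ D : Finset (BlockTriple kX kY kZ n), D ⊆ A₀ ×ˢ A₀ ×ˢ A₀ ∧ D.Nonempty ∧
      (∀ e ∈ Φ₀ ×ˢ Φ₀ ×ˢ Φ₀, ∀ d₁ ∈ D, ∀ d₂ ∈ D, ∀ d₃ ∈ D, labelX e = labelX d₁ →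
        labelY e = labelY d₂ → labelZ e = labelZ d₃ → d₁ = d₂ ∧ d₁ = d₃) ∧
      3 * Real.log A₀.card - Real.log a - Real.log b - Real.log c -
        3 / 2 * (Real.log Φ₀.card - Real.log A₀.card) - Real.log 18 -
        Real.log (26 + 2 * kX + 2 * kY + 2 * kZ) - 4 * √(Real.log (26 + 2 * kX + 2 * kY + 2 * kZ) +
          Real.log a + Real.log b + Real.log c) ≤ Real.log D.card := by
  classical
  obtain ⟨f₀, hf₀⟩ := hA₀
  have posa := ha.pos ⟨f₀, hf₀⟩
  have posb := hb.pos ⟨f₀, hf₀⟩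
  have posc := hc.pos ⟨f₀, hf₀⟩
  obtain ⟨R, hRdef⟩ : ∃ R, R = a * b * c := ⟨_, rfl⟩
  have posR : 0 < R := by rw [hRdef]; positivity
  obtain ⟨M, hMp, hlt, hle⟩ :=
    Nat.exists_prime_lt_and_le_two_mul (12 * R + kX + kY + kZ + 1) (by omega)
  have : Fact M.Prime := ⟨hMp⟩
  have hM2 : M ≠ 2 := by omega
  obtain ⟨S', hfree, hcard⟩ := exists_threeAPFree_zmod hM2
  obtain ⟨Φ, hΦdef⟩ : ∃ Φ, Φ = (Φ₀ ×ˢ Φ₀ ×ˢ Φ₀).image (tripleCode M) := ⟨_, rfl⟩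
  obtain ⟨A, hAdef⟩ : ∃ A, A = (A₀ ×ˢ A₀ ×ˢ A₀).image (tripleCode M) := ⟨_, rfl⟩
  have injX := labelCode_injective (n := n) (M := M) (a := kX) (b := kY) (c := kZ)
    (by omega) (by omega) (by omega)
  have injY := labelCode_injective (n := n) (M := M) (a := kY) (b := kZ) (c := kX)
    (by omega) (by omega) (by omega)
  have injZ := labelCode_injective (n := n) (M := M) (a := kZ) (b := kX) (c := kY)
    (by omega) (by omega) (by omega)
  have inj : Function.Injective (tripleCode M : BlockTriple kX kY kZ n → _) := by
    intro d e h
    simp only [tripleCode, Prod.mk.injEq] at h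
    exact blockTriple_ext (injX h.1) (injY h.2.1) (injZ h.2.2)
  have cardΦ : Φ.card = Φ₀.card ^ 3 := by
    rw [hΦdef, Finset.card_image_of_injective _ inj, Finset.card_product, Finset.card_product]
    ring
  have cardA : A.card = A₀.card ^ 3 := by
    rw [hAdef, Finset.card_image_of_injective _ inj, Finset.card_product, Finset.card_product]
    ring
  have hΦ : ∀ p ∈ Φ, p.1 + p.2.1 + p.2.2 = fun _ => ((P - 3 : ℤ) : ZMod M) := by
    intro p hp
    rw [hΦdef] at hp
    obtain ⟨d, hd, rfl⟩ := Finset.mem_image.1 hp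
    simp only [Finset.mem_product] at hd
    exact tripleCode_sum M hS fun l => ⟨hΦ₀ _ hd.1 l, hΦ₀ _ hd.2.1 l, hΦ₀ _ hd.2.2 l⟩
  have hAΦ : A ⊆ Φ := by
    rw [hAdef, hΦdef]
    exact Finset.image_subset_image (Finset.product_subset_product hsub
      (Finset.product_subset_product hsub hsub))
  have fX : FiberBound A (fun p => p.1) R := by
    rw [hAdef, hRdef]
    exact (ha.prod hb hc).image injX fun _ => rfl
  have fY : FiberBound A (fun p => p.2.1) R := by
    rw [hAdef, hRdef, show a * b * c = b * c * a by ring]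
    exact (hb.prod hc ha).image injY fun _ => rfl
  have fZ : FiberBound A (fun p => p.2.2) R := by
    rw [hAdef, hRdef, show a * b * c = c * a * b by ring]
    exact (hc.prod ha hb).image injZ fun _ => rfl
  have pos₀ : (0 : ℝ) < A₀.card := by exact_mod_cast Finset.card_pos.2 ⟨f₀, hf₀⟩
  have le₀ : (A₀.card : ℝ) ≤ Φ₀.card := by exact_mod_cast Finset.card_le_card hsub
  have pos₁ : (0 : ℝ) < Φ₀.card := pos₀.trans_le le₀
  obtain ⟨Q, hQ, hQ2, hQlog⟩ := exists_nat_sq_ge (x := (Φ₀.card / A₀.card : ℝ) ^ 3)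
    (one_le_pow₀ (by rwa [le_div_iff₀ pos₀, one_mul]))
  have hQ' : 4 * Φ.card ≤ A.card * Q ^ 2 := by
    rw [cardΦ, cardA]
    rw [div_pow, ← mul_div_assoc, div_le_iff₀ (by positivity)] at hQ2
    have : (4 * Φ₀.card ^ 3 : ℝ) ≤ A₀.card ^ 3 * Q ^ 2 := by linarith
    exact_mod_cast this
  obtain ⟨D, hDA, hD, hDcard⟩ := exists_inducedMatching hM2 hfree Φ A hΦ hAΦ R
    (fun x => fX.card_filter_le x) (fun y => fY.card_filter_le y)
    (fun z => fZ.card_filter_le z) (by omega) Q hQ hQ'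
  obtain ⟨D', hD'⟩ : ∃ D', D' = (A₀ ×ˢ A₀ ×ˢ A₀).filter fun d => tripleCode M d ∈ D := ⟨_, rfl⟩
  have cardD : D'.card = D.card := by
    rw [← Finset.card_image_of_injective D' inj]
    congr 1
    ext p
    simp only [hD', Finset.mem_image, Finset.mem_filter]
    constructor
    · rintro ⟨d, hd, rfl⟩
      exact hd.2
    · intro hp
      have hpA := hDA hp
      rw [hAdef] at hpA
      obtain ⟨d, hd, rfl⟩ := Finset.mem_image.1 hpA
      exact ⟨d, ⟨hd, hp⟩, rfl⟩
  have hM0 : (0 : ℝ) < M := by exact_mod_cast hMp.pos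
  have hQ0 : (0 : ℝ) < Q := by exact_mod_cast hQ
  have hS0 : (0 : ℝ) < S'.card := lt_of_lt_of_le (by positivity) hcard
  have hDpos : (0 : ℝ) < D'.card := by
    rw [cardA, ← cardD] at hDcard
    by_contra h
    have h0 : (D'.card : ℝ) = 0 := le_antisymm (not_lt.1 h) (Nat.cast_nonneg _)
    rw [h0, mul_zero] at hDcard
    have : (0 : ℝ) < (A₀.card ^ 3 : ℕ) * S'.card := by push_cast; positivity
    linarith
  refine ⟨D', hD' ▸ Finset.filter_subset _ _, ?_, ?_, ?_⟩
  · rw [← Finset.card_pos]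
    exact_mod_cast hDpos
  · intro e he d₁ h₁ d₂ h₂ d₃ h₃ e₁ e₂ e₃
    rw [hD'] at h₁ h₂ h₃
    have key := hD (tripleCode M e) (hΦdef ▸ Finset.mem_image_of_mem _ he)
      _ (Finset.mem_filter.1 h₁).2 _ (Finset.mem_filter.1 h₂).2 _ (Finset.mem_filter.1 h₃).2
      (by simp only [tripleCode, e₁]) (by simp only [tripleCode, e₂])
      (by simp only [tripleCode, e₃])
    exact ⟨inj key.1, inj key.2⟩
  · have posa' : (0 : ℝ) < a := by exact_mod_cast posa
    have posb' : (0 : ℝ) < b := by exact_mod_cast posb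
    have posc' : (0 : ℝ) < c := by exact_mod_cast posc
    have h1 : M ≤ (26 + 2 * kX + 2 * kY + 2 * kZ) * R := by
      have : kX + kY + kZ + 1 ≤ (kX + kY + kZ + 1) * R := Nat.le_mul_of_pos_right _ posR
      calc M ≤ 2 * (12 * R + kX + kY + kZ + 1) := hle
        _ ≤ 2 * (12 * R + (kX + kY + kZ + 1) * R) := by omega
        _ = _ := by ring
    have h2 : (M : ℝ) ≤ (26 + 2 * kX + 2 * kY + 2 * kZ) * (a * b * c) := by
      rw [hRdef] at h1
      exact_mod_cast h1
    rw [cardA, ← cardD] at hDcard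
    push_cast at hDcard
    exact log_matching_ge (by positivity) posa' posb' posc' pos₀ pos₁ hM0 hQ0 hDpos h2 hcard
      hDcard hQlog

end BlockSequences

/-! ### Asymptotics of the matching -/

section Asymptotics

variable {kX kY kZ n : ℕ}

/-- Upper semicontinuity of a constrained maximum over a compact set. -/
theorem exists_le_add_of_dist_le {E B : Type*} [TopologicalSpace E] [PseudoMetricSpace B]
    {K : Set E} (hK : IsCompact K) {H : E → ℝ} (hH : Continuous H) {m : E → B} (hm : Continuous m)
    {b : B} {h : ℝ} (hle : ∀ β ∈ K, dist (m β) b = 0 → H β ≤ h) {δ : ℝ} (hδ : 0 < δ) :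
    ∃ η > 0, ∀ β ∈ K, dist (m β) b ≤ η → H β ≤ h + δ := by
  set K' := K ∩ {β | h + δ ≤ H β} with hK'def
  have hK' : IsCompact K' := hK.inter_right (isClosed_le continuous_const hH)
  rcases K'.eq_empty_or_nonempty with h0 | hne
  · refine ⟨1, one_pos, fun β hβ _ => ?_⟩
    by_contra hlt
    have : β ∈ K' := ⟨hβ, (not_le.1 hlt).le⟩
    rw [h0] at this
    exact this
  · obtain ⟨β₀, hβ₀, hmin⟩ := hK'.exists_isMinOn hne
      (f := fun β => dist (m β) b) (by fun_prop)
    have hpos : 0 < dist (m β₀) b := by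
      refine lt_of_le_of_ne dist_nonneg fun h0 => ?_
      have h1 := hle β₀ hβ₀.1 h0.symm
      have h2 : h + δ ≤ H β₀ := hβ₀.2
      linarith
    refine ⟨dist (m β₀) b / 2, half_pos hpos, fun β hβ hd => ?_⟩
    by_contra hlt
    have h1 : dist (m β₀) b ≤ dist (m β) b := hmin ⟨hβ, (not_le.1 hlt).le⟩
    linarith

theorem isCompact_distributions {A : Type*} [Fintype A] (S : Finset A) :
    IsCompact {β : A → ℝ | (∀ s, 0 ≤ β s) ∧ ∑ s, β s = 1 ∧ ∀ s ∉ S, β s = 0} := by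
  refine (isCompact_stdSimplex ℝ A).of_isClosed_subset ?_ fun β hβ => ⟨hβ.1, hβ.2.1⟩
  simp only [Set.ofPred_and, Set.ofPred_forall]
  refine (isClosed_iInter fun s => isClosed_le continuous_const (continuous_apply s)).inter
    ((isClosed_eq (by fun_prop) continuous_const).inter
      (isClosed_iInter fun s => isClosed_iInter fun _ =>
        isClosed_eq (continuous_apply s) continuous_const))

theorem continuous_marginal {A B : Type*} [Fintype A] [DecidableEq B] (g : A → B) :
    Continuous (marginal g) := by
  refine continuous_pi fun b => ?_
  unfold marginal
  refine continuous_finsetSum _ fun s _ => ?_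
  split_ifs
  · exact continuous_apply s
  · exact continuous_const

theorem abs_marginal_sub_le {A B : Type*} [Fintype A] [DecidableEq B] (g : A → B) {α β : A → ℝ}
    {ε : ℝ} (h : ∀ s, |β s - α s| ≤ ε) (b : B) :
    |marginal g β b - marginal g α b| ≤ Fintype.card A * ε := by
  rw [marginal, marginal, ← Finset.sum_sub_distrib]
  refine (Finset.abs_sum_le_sum_abs _ _).trans ?_
  rw [← nsmul_eq_mul, ← Finset.card_univ, ← Finset.sum_const]
  refine Finset.sum_le_sum fun s _ => ?_
  split_ifs
  · exact h s
  · simpa using (abs_nonneg _).trans (h s)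

theorem dist_marginal_le {A B : Type*} [Fintype A] [Fintype B] [DecidableEq B] (g : A → B)
    {α β : A → ℝ} {ε η : ℝ} (h : ∀ s, |β s - α s| ≤ ε) (hη : 0 ≤ η)
    (hε : Fintype.card A * ε ≤ η) : dist (marginal g β) (marginal g α) ≤ η :=
  (dist_pi_le_iff hη).2 fun b => (abs_marginal_sub_le g h b).trans hε

theorem marginal_div_eq {A B : Type*} [Fintype A] [DecidableEq A] [DecidableEq B] (g : A → B)
    (f : Fin n → A) :
    marginal g (fun s => (letterCount f s : ℝ) / n) = fun b => (letterCount (g ∘ f) b : ℝ) / n := by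
  funext b
  rw [letterCount_comp, marginal, Nat.cast_sum, Finset.sum_div]
  refine Finset.sum_congr rfl fun s _ => ?_
  split_ifs <;> simp

/-- A set of sequences whose types all have entropy at most `h` has at most `exp (n h)` elements,
up to a polynomial factor. -/
theorem card_le_of_entropy_le {A : Type*} [Fintype A] [DecidableEq A] (hn : 0 < n)
    (Φ : Finset (Fin n → A)) {h : ℝ}
    (hΦ : ∀ f ∈ Φ, entropy (fun s => (letterCount f s : ℝ) / n) ≤ h) :
    (Φ.card : ℝ) ≤ ((n : ℝ) + 1) ^ Fintype.card A * Real.exp (n * h) := by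
  let ty : (Fin n → A) → (A → Fin (n + 1)) := fun f s =>
    ⟨letterCount f s, Nat.lt_succ_of_le (letterCount_le f s)⟩
  rw [Finset.card_eq_sum_card_fiberwise (f := ty) (t := Finset.univ) (fun _ _ => by simp)]
  push_cast
  have hle : ∀ t ∈ (Finset.univ : Finset (A → Fin (n + 1))),
      ((Φ.filter fun f => ty f = t).card : ℝ) ≤ Real.exp (n * h) := by
    intro t _
    rcases (Φ.filter fun f => ty f = t).eq_empty_or_nonempty with h0 | ⟨f, hf⟩
    · rw [h0]
      simpa using (Real.exp_pos _).le
    · rw [Finset.mem_filter] at hf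
      have hsub : (Φ.filter fun f => ty f = t) ⊆ typeClass n (letterCount f) := by
        intro f' hf'
        rw [Finset.mem_filter] at hf'
        rw [mem_typeClass]
        funext s
        have := congrFun (hf'.2.trans hf.2.symm) s
        exact congrArg Fin.val this
      calc ((Φ.filter fun f => ty f = t).card : ℝ) ≤ (typeClass n (letterCount f)).card := by
            exact_mod_cast Finset.card_le_card hsub
        _ ≤ _ := card_typeClass_le hn _
        _ ≤ _ := by
            gcongr
            exact hΦ f hf.1
  refine (Finset.sum_le_card_nsmul _ _ _ hle).trans ?_
  rw [nsmul_eq_mul, Finset.card_univ, Fintype.card_fun, Fintype.card_fin]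
  push_cast
  exact le_rfl

theorem log_add_one_le_sqrt {x : ℝ} (hx : 1 ≤ x) : Real.log (x + 1) ≤ 4 * √x := by
  have h1 : Real.log (x + 1) = 2 * Real.log √(x + 1) := by
    rw [Real.log_sqrt (by linarith)]
    ring
  have h2 : Real.log √(x + 1) ≤ √(x + 1) :=
    (Real.log_le_sub_one_of_pos (Real.sqrt_pos.2 (by linarith))).trans (by linarith)
  have h3 : √(x + 1) ≤ 2 * √x := by
    rw [Real.sqrt_le_left (by positivity), mul_pow, Real.sq_sqrt (by linarith)]
    linarith
  linarith

/-- The subexponential losses are negligible. -/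
theorem exists_sublinear_le (p q r s : ℝ) (hp : 0 ≤ p) {c : ℝ} (hc : 0 < c) :
    ∃ n₀ : ℕ, ∀ n ≥ n₀, p * Real.log (n + 1) + q + 4 * √(r + s * n) ≤ c * n := by
  set K := 4 * p + |q| + 4 * √(|r| + |s|) with hK
  have hK0 : 0 ≤ K := by positivity
  refine ⟨⌈(K / c) ^ 2⌉₊ + 1, fun n hn => ?_⟩
  have hn1 : (1 : ℝ) ≤ n := by exact_mod_cast (by omega : 1 ≤ n)
  have hs1 : 1 ≤ √(n : ℝ) := Real.one_le_sqrt.2 hn1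
  have hn2 : (K / c) ^ 2 ≤ n := (Nat.le_ceil _).trans (by exact_mod_cast (by omega))
  have hn3 : K ≤ c * √n := by
    have := Real.le_sqrt_of_sq_le hn2
    rwa [div_le_iff₀' hc] at this
  have h1 := mul_le_mul_of_nonneg_left (log_add_one_le_sqrt hn1) hp
  have h2 : q ≤ |q| * √n := (le_abs_self q).trans (le_mul_of_one_le_right (abs_nonneg q) hs1)
  have h3 : √(r + s * n) ≤ √(|r| + |s|) * √n := by
    rw [← Real.sqrt_mul (by positivity)]
    refine Real.sqrt_le_sqrt ?_
    have e1 : r ≤ |r| * n := (le_abs_self r).trans (le_mul_of_one_le_right (abs_nonneg r) hn1)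
    have e2 : s * n ≤ |s| * n := mul_le_mul_of_nonneg_right (le_abs_self s) (by linarith)
    linarith
  calc p * Real.log (n + 1) + q + 4 * √(r + s * n) ≤ K * √n := by rw [hK]; linarith
    _ ≤ c * √n * √n := by gcongr
    _ = c * n := by rw [mul_assoc, Real.mul_self_sqrt (by linarith)]

/-- The fibres of a type class over a quotient alphabet, compared with the entropy of the
marginal. -/
theorem exists_fiberBound {A B : Type*} [Fintype A] [DecidableEq A] [Fintype B] [DecidableEq B]
    {α : A → ℝ} (h0 : ∀ s, 0 ≤ α s) {t : A → ℕ} {ε : ℝ}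
    (ht : ∀ s, |(t s : ℝ) - n * α s| ≤ ε * n) (hpos : ∀ s, t s ≠ 0 → α s ≠ 0)
    (hne : (typeClass n t).Nonempty) (g : A → B) :
    ∃ a : ℕ, FiberBound (typeClass n t) (fun f l => g (f l)) a ∧
      Real.log a ≤ n * (-entropy (marginal g α)) +
        ε * n * ∑ s, |Real.log (marginal g α (g s))| - Real.log (∏ s, α s ^ t s) := by
  have hw : 0 < ∏ s, α s ^ t s := by
    refine Finset.prod_pos fun s _ => ?_
    rcases eq_or_ne (t s) 0 with h | h
    · simp [h]
    · exact pow_pos (lt_of_le_of_ne (h0 s) (hpos s h).symm) _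
  have hm : ∀ s, t s ≠ 0 → marginal g α (g s) ≠ 0 := by
    intro s hs
    have h1 : α s ≤ marginal g α (g s) := by
      have := Finset.single_le_sum (f := fun r => if g r = g s then α r else 0)
        (fun r _ => by split_ifs; exacts [h0 r, le_rfl]) (Finset.mem_univ s)
      rw [if_pos rfl] at this
      exact this
    exact (lt_of_lt_of_le (lt_of_le_of_ne (h0 s) (hpos s hs).symm) h1).ne'
  set wg := ∏ s, marginal g α (g s) ^ t s with hwg
  have hbound : FiberBound (typeClass n t) (fun f l => g (f l)) ⌊wg / ∏ s, α s ^ t s⌋₊ := by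
    intro u s hs hu
    refine Nat.le_floor ?_
    rw [le_div_iff₀ hw]
    refine le_trans ?_ (card_typeClass_fiber_mul_le h0 g t u)
    gcongr
    intro f hf
    exact Finset.mem_filter.2 ⟨hs hf, hu f hf⟩
  refine ⟨_, hbound, ?_⟩
  have hfl : (0 : ℝ) < ⌊wg / ∏ s, α s ^ t s⌋₊ := by exact_mod_cast hbound.pos hne
  have hwg0 : 0 < wg := by
    by_contra h
    rw [Nat.floor_of_nonpos (div_nonpos_of_nonpos_of_nonneg (not_lt.1 h) hw.le)] at hfl
    simp at hfl
  have h1 : Real.log ⌊wg / ∏ s, α s ^ t s⌋₊ ≤ Real.log wg - Real.log (∏ s, α s ^ t s) := by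
    rw [← Real.log_div hwg0.ne' hw.ne']
    exact Real.log_le_log hfl (Nat.floor_le (by positivity))
  have h2 := log_prod_pow_le (w := fun s => marginal g α (g s)) ht hm
  rw [sum_mul_log_marginal] at h2
  linarith

/-- A crude linear bound, used only under the square root of the loss from hashing. -/
theorem neg_le_log_prod_pow {A : Type*} [Fintype A] [DecidableEq A] (α : A → ℝ) (f : Fin n → A)
    (hpos : ∀ s, letterCount f s ≠ 0 → α s ≠ 0) :
    -(n * ∑ s, |Real.log (α s)|) ≤ Real.log (∏ s, α s ^ letterCount f s) := by
  rw [Real.log_prod fun s _ => ?_, Finset.mul_sum, ← Finset.sum_neg_distrib]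
  · refine Finset.sum_le_sum fun s _ => ?_
    rw [Real.log_pow]
    have h1 : -|Real.log (α s)| ≤ Real.log (α s) := neg_abs_le _
    have h2 : (letterCount f s : ℝ) ≤ n := by exact_mod_cast letterCount_le f s
    have h3 := mul_le_mul_of_nonneg_right h2 (abs_nonneg (Real.log (α s)))
    have h4 := mul_le_mul_of_nonneg_left h1 (Nat.cast_nonneg (α := ℝ) (letterCount f s))
    linarith
  · by_cases h : letterCount f s = 0
    · simp [h]
    · exact pow_ne_zero _ (hpos s h)

/-- For a distribution `α` on the block indices, there are arbitrarily long sequences of a type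
close to `α` whose triples contain an induced matching of the size predicted by the entropies. -/
theorem exists_large_matching {P : ℤ} {S : Finset (Fin kX × Fin kY × Fin kZ)}
    (hS : ∀ s ∈ S,
      ((s.1 : ℕ) + 1 : ℤ) + ((s.2.1 : ℕ) + 1 : ℤ) + ((s.2.2 : ℕ) + 1 : ℤ) = P)
    {α : Fin kX × Fin kY × Fin kZ → ℝ} (h0 : ∀ s, 0 ≤ α s) (h1 : ∑ s, α s = 1)
    (hsupp : ∀ s ∉ S, α s = 0) {h : ℝ}
    (hmax : ∀ β : Fin kX × Fin kY × Fin kZ → ℝ, (∀ s, 0 ≤ β s) → ∑ s, β s = 1 →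
      (∀ s ∉ S, β s = 0) → marginal (fun s => s.1) β = marginal (fun s => s.1) α →
      marginal (fun s => s.2.1) β = marginal (fun s => s.2.1) α →
      marginal (fun s => s.2.2) β = marginal (fun s => s.2.2) α → entropy β ≤ h)
    {δ : ℝ} (hδ : 0 < δ) (n₁ : ℕ) :
    ∃ n ≥ n₁, 0 < n ∧ ∃ t : Fin kX × Fin kY × Fin kZ → ℕ, (∀ s, |(t s : ℝ) - n * α s| ≤ δ * n) ∧
      (∀ f ∈ typeClass n t, ∀ l, f l ∈ S) ∧
      ∃ D : Finset (BlockTriple kX kY kZ n),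
        D ⊆ typeClass n t ×ˢ typeClass n t ×ˢ typeClass n t ∧ D.Nonempty ∧
        (∀ e : BlockTriple kX kY kZ n, (∀ l, e.1 l ∈ S ∧ e.2.1 l ∈ S ∧ e.2.2 l ∈ S) →
          ∀ d₁ ∈ D, ∀ d₂ ∈ D, ∀ d₃ ∈ D, labelX e = labelX d₁ → labelY e = labelY d₂ →
            labelZ e = labelZ d₃ → d₁ = d₂ ∧ d₁ = d₃) ∧
        n * (entropy (marginal (fun s => s.1) α) + entropy (marginal (fun s => s.2.1) α) +
          entropy (marginal (fun s => s.2.2) α) + 3 / 2 * (entropy α - h) - δ) ≤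
            Real.log D.card := by
  set gX : Fin kX × Fin kY × Fin kZ → Fin kX := fun s => s.1 with hgX
  set gY : Fin kX × Fin kY × Fin kZ → Fin kY := fun s => s.2.1 with hgY
  set gZ : Fin kX × Fin kY × Fin kZ → Fin kZ := fun s => s.2.2 with hgZ
  obtain ⟨η, hη, hηle⟩ := exists_le_add_of_dist_le (isCompact_distributions S) continuous_entropy
    (m := fun β => (marginal gX β, marginal gY β, marginal gZ β))
    (b := (marginal gX α, marginal gY α, marginal gZ α)) (h := h)
    ((continuous_marginal _).prodMk ((continuous_marginal _).prodMk (continuous_marginal _)))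
    (fun β hβ hd => by
      rw [dist_eq_zero, Prod.mk.injEq, Prod.mk.injEq] at hd
      exact hmax β hβ.1 hβ.2.1 hβ.2.2 hd.1 hd.2.1 hd.2.2) (δ := δ / 6) (by positivity)
  set L := ∑ s, |Real.log (α s)| with hL
  set LX := ∑ s, |Real.log (marginal gX α (gX s))| with hLX
  set LY := ∑ s, |Real.log (marginal gY α (gY s))| with hLY
  set LZ := ∑ s, |Real.log (marginal gZ α (gZ s))| with hLZ
  have L0 : 0 ≤ L := Finset.sum_nonneg fun _ _ => abs_nonneg _
  have LX0 : 0 ≤ LX := Finset.sum_nonneg fun _ _ => abs_nonneg _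
  have LY0 : 0 ≤ LY := Finset.sum_nonneg fun _ _ => abs_nonneg _
  have LZ0 : 0 ≤ LZ := Finset.sum_nonneg fun _ _ => abs_nonneg _
  set k := Fintype.card (Fin kX × Fin kY × Fin kZ) with hk
  -- the first bound on `ε` is for the type, the second for the competing distributions, the third
  -- for the entropies
  obtain ⟨ε, hε, hεδ, hεη, hεL⟩ : ∃ ε > 0, ε ≤ δ ∧ k * ε ≤ η ∧
      ε * (LX + LY + LZ + 3 / 2 * L) ≤ δ / 4 := by
    refine ⟨min δ (min (η / (k + 1)) (δ / (4 * (LX + LY + LZ + 3 / 2 * L + 1)))),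
      lt_min hδ (lt_min (by positivity) (by positivity)), min_le_left _ _, ?_, ?_⟩
    · calc (k : ℝ) * _ ≤ (k + 1) * (η / (k + 1)) := by
            gcongr
            · linarith
            · exact (min_le_right _ _).trans (min_le_left _ _)
        _ = η := by field_simp
    · calc _ ≤ δ / (4 * (LX + LY + LZ + 3 / 2 * L + 1)) * (LX + LY + LZ + 3 / 2 * L + 1) := by
            refine mul_le_mul ?_ (by linarith) (by positivity) (by positivity)
            exact (min_le_right _ _).trans (min_le_right _ _)
        _ = δ / 4 := by field_simp
  set κ : ℝ := 26 + 2 * kX + 2 * kY + 2 * kZ with hκ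
  obtain ⟨n₂, hn₂⟩ := exists_sublinear_le (6 * k)
    (9 / 2 * Real.log 2 + Real.log 18 + Real.log κ) (Real.log κ)
    (-entropy (marginal gX α) - entropy (marginal gY α) - entropy (marginal gZ α) +
      ε * (LX + LY + LZ) + 3 * L) (by positivity) (c := δ / 4) (by positivity)
  obtain ⟨n, hn, hn2, hn0, hnε⟩ : ∃ n, n ≥ n₁ ∧ n ≥ n₂ ∧ 0 < n ∧ 2 * k ≤ ε ^ 2 * n := by
    refine ⟨n₁ + n₂ + 1 + ⌈2 * k / ε ^ 2⌉₊, by omega, by omega, by omega, ?_⟩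
    rw [← div_le_iff₀' (by positivity)]
    exact (Nat.le_ceil _).trans (by exact_mod_cast (by omega))
  have hnR : (0 : ℝ) < n := by exact_mod_cast hn0
  obtain ⟨t, ht, hprob⟩ := exists_typical_type h0 h1 hε hnε
  change _ ≤ ∑ f ∈ typeClass n t, _ at hprob
  rw [sum_typeClass] at hprob
  have hπ : (0 : ℝ) < 1 / (2 * ((n : ℝ) + 1) ^ k) := by positivity
  have hprod := hπ.trans_le hprob
  have hw : 0 < ∏ s, α s ^ t s := by
    refine lt_of_le_of_ne (Finset.prod_nonneg fun s _ => pow_nonneg (h0 s) _) fun h => ?_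
    rw [← h, mul_zero] at hprod
    exact lt_irrefl _ hprod
  have hcard : (0 : ℝ) < (typeClass n t).card := by
    refine lt_of_le_of_ne (Nat.cast_nonneg _) fun h => ?_
    rw [← h, zero_mul] at hprod
    exact lt_irrefl _ hprod
  have hne : (typeClass n t).Nonempty := Finset.card_pos.1 (by exact_mod_cast hcard)
  have hpos : ∀ s, t s ≠ 0 → α s ≠ 0 := fun s hs hα => by
    refine hw.ne' (Finset.prod_eq_zero (Finset.mem_univ s) ?_)
    rw [hα, zero_pow hs]
  have hletters : ∀ f ∈ typeClass n t, ∀ l, f l ∈ S := by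
    intro f hf l
    by_contra hl
    refine hpos (f l) ?_ (hsupp _ hl)
    rw [← mem_typeClass.1 hf]
    exact (letterCount_pos f l).ne'
  obtain ⟨f₀, hf₀⟩ := hne
  have hf₀t := mem_typeClass.1 hf₀
  obtain ⟨a, ha, loga⟩ := exists_fiberBound h0 ht hpos ⟨f₀, hf₀⟩ gX
  obtain ⟨b, hb, logb⟩ := exists_fiberBound h0 ht hpos ⟨f₀, hf₀⟩ gY
  obtain ⟨c, hc, logc⟩ := exists_fiberBound h0 ht hpos ⟨f₀, hf₀⟩ gZ
  -- all sequences of nonzero blocks with the same marginal counts as the type `t`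
  let Φ₀ : Finset (Fin n → Fin kX × Fin kY × Fin kZ) := Finset.univ.filter fun f =>
    (∀ l, f l ∈ S) ∧ letterCount (gX ∘ f) = letterCount (gX ∘ f₀) ∧
      letterCount (gY ∘ f) = letterCount (gY ∘ f₀) ∧ letterCount (gZ ∘ f) = letterCount (gZ ∘ f₀)
  have mem_Φ₀ : ∀ f, f ∈ Φ₀ ↔ (∀ l, f l ∈ S) ∧
      letterCount (gX ∘ f) = letterCount (gX ∘ f₀) ∧
      letterCount (gY ∘ f) = letterCount (gY ∘ f₀) ∧
      letterCount (gZ ∘ f) = letterCount (gZ ∘ f₀) := fun f => by simp [Φ₀]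
  have count_eq : ∀ {B : Type} [DecidableEq B] (g : Fin kX × Fin kY × Fin kZ → B),
      ∀ f ∈ typeClass n t, letterCount (g ∘ f) = letterCount (g ∘ f₀) := by
    intro B _ g f hf
    funext b
    rw [letterCount_comp, letterCount_comp, mem_typeClass.1 hf, hf₀t]
  have hsub : typeClass n t ⊆ Φ₀ := fun f hf =>
    (mem_Φ₀ f).2 ⟨hletters f hf, count_eq gX f hf, count_eq gY f hf, count_eq gZ f hf⟩
  obtain ⟨D, hDsub, hDne, hD, hDlog⟩ := exists_blockTriple_matching hS (typeClass n t) Φ₀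
    ⟨f₀, hf₀⟩ hsub (fun f hf => ((mem_Φ₀ f).1 hf).1) ha hb hc
  refine ⟨n, hn, hn0, t, fun s => (ht s).trans (by gcongr), hletters, D, hDsub, hDne, ?_, ?_⟩
  · intro e he d₁ h₁ d₂ h₂ d₃ h₃ e₁ e₂ e₃
    refine hD e ?_ d₁ h₁ d₂ h₂ d₃ h₃ e₁ e₂ e₃
    have m₁ := hDsub h₁
    have m₂ := hDsub h₂
    have m₃ := hDsub h₃
    simp only [Finset.mem_product] at m₁ m₂ m₃
    simp only [labelX, labelY, labelZ, Prod.mk.injEq] at e₁ e₂ e₃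
    simp only [Finset.mem_product, mem_Φ₀]
    refine ⟨⟨fun l => (he l).1, ?_, ?_, ?_⟩, ⟨fun l => (he l).2.1, ?_, ?_, ?_⟩,
      ⟨fun l => (he l).2.2, ?_, ?_, ?_⟩⟩
    · exact (congrArg letterCount e₁.1).trans (count_eq gX _ m₁.1)
    · exact (congrArg letterCount e₂.1).trans (count_eq gY _ m₂.1)
    · exact (congrArg letterCount e₃.1).trans (count_eq gZ _ m₃.1)
    · exact (congrArg letterCount e₃.2.1).trans (count_eq gX _ m₃.2.1)
    · exact (congrArg letterCount e₁.2.1).trans (count_eq gY _ m₁.2.1)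
    · exact (congrArg letterCount e₂.2.1).trans (count_eq gZ _ m₂.2.1)
    · exact (congrArg letterCount e₂.2.2).trans (count_eq gX _ m₂.2.2)
    · exact (congrArg letterCount e₃.2.2).trans (count_eq gY _ m₃.2.2)
    · exact (congrArg letterCount e₁.2.2).trans (count_eq gZ _ m₁.2.2)
  · have hΦent : ∀ f ∈ Φ₀, entropy (fun s => (letterCount f s : ℝ) / n) ≤ h + δ / 6 := by
      intro f hf
      obtain ⟨hfS, fX, fY, fZ⟩ := (mem_Φ₀ f).1 hf
      refine hηle _ ⟨fun s => by positivity, ?_, ?_⟩ ?_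
      · rw [← Finset.sum_div, ← Nat.cast_sum, sum_letterCount, div_self hnR.ne']
      · intro s hs
        have : letterCount f s = 0 := by
          rw [letterCount, Finset.card_eq_zero, Finset.filter_eq_empty_iff]
          intro l _ hl
          exact hs (hl ▸ hfS l)
        simp [this]
      · have hclose : ∀ s, |(letterCount f₀ s : ℝ) / n - α s| ≤ ε := by
          intro s
          rw [hf₀t, div_sub' hnR.ne', abs_div, abs_of_pos hnR, div_le_iff₀ hnR]
          exact ht s
        have dX := dist_marginal_le gX hclose hη.le hεη
        have dY := dist_marginal_le gY hclose hη.le hεη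
        have dZ := dist_marginal_le gZ hclose hη.le hεη
        rw [marginal_div_eq] at dX dY dZ
        rw [marginal_div_eq, marginal_div_eq, marginal_div_eq, fX, fY, fZ]
        exact max_le dX (max_le dY dZ)
    have hΦcard := card_le_of_entropy_le hn0 Φ₀ hΦent
    have hΦpos : (0 : ℝ) < Φ₀.card :=
      hcard.trans_le (by exact_mod_cast Finset.card_le_card hsub)
    have logΦ : Real.log Φ₀.card ≤ k * Real.log (n + 1) + n * (h + δ / 6) := by
      have := Real.log_le_log hΦpos hΦcard
      rwa [Real.log_mul (by positivity) (Real.exp_pos _).ne', Real.log_exp, Real.log_pow] at this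
    have logπ : -Real.log 2 - k * Real.log (n + 1) ≤
        Real.log (typeClass n t).card + Real.log (∏ s, α s ^ t s) := by
      have := Real.log_le_log hπ hprob
      rw [Real.log_mul hcard.ne' hw.ne', Real.log_div one_ne_zero (by positivity), Real.log_one,
        Real.log_mul (by norm_num) (by positivity), Real.log_pow] at this
      linarith
    have logw := log_prod_pow_le ht hpos
    rw [sum_mul_log_self] at logw
    have logw' := neg_le_log_prod_pow α f₀ (by rw [hf₀t]; exact hpos)
    rw [hf₀t] at logw'
    have hsqrt : √(Real.log κ + Real.log a + Real.log b + Real.log c) ≤ √(Real.log κ +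
        (-entropy (marginal gX α) - entropy (marginal gY α) - entropy (marginal gZ α) +
          ε * (LX + LY + LZ) + 3 * L) * n) := by
      refine Real.sqrt_le_sqrt ?_
      linarith
    have hsub := hn₂ n hn2
    have hδn := mul_pos hδ hnR
    rw [← hκ] at hDlog
    rw [← hLX] at loga
    rw [← hLY] at logb
    rw [← hLZ] at logc
    rw [← hL] at logw
    have hεn : ε * (LX + LY + LZ + 3 / 2 * L) * n ≤ δ / 4 * n := by gcongr
    linarith

end Asymptotics

/-! ### The tensor of a block triple -/

section Blocks

variable {F : Type*} [Field F]

theorem exists_perm_of_letterCount_eq {A : Type*} [DecidableEq A] {n : ℕ} {f g : Fin n → A}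
    (h : letterCount f = letterCount g) : ∃ σ : Equiv.Perm (Fin n), ∀ l, g (σ l) = f l := by
  have e : ∀ s, Nonempty ({l // f l = s} ≃ {l // g l = s}) := fun s => by
    refine ⟨Fintype.equivOfCardEq ?_⟩
    rw [Fintype.card_subtype, Fintype.card_subtype]
    exact congrFun h s
  exact ⟨(Equiv.sigmaFiberEquiv f).symm.trans
    ((Equiv.sigmaCongrRight fun s => (e s).some).trans (Equiv.sigmaFiberEquiv g)),
    fun l => ((e (f l)).some ⟨l, rfl⟩).2⟩

/-- A Kronecker product of nonzero tensors contains that of the factors with indices in the range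
of an injective map, which may be grouped arbitrarily. -/
theorem piKron_sigma_isRestrictionOf {X Y Z : Type*} [Fintype X] [Fintype Y] [Fintype Z]
    {ι : Type} [Fintype ι] {κ : ι → Type} [∀ p, Fintype (κ p)] {n : ℕ}
    {G : Fin n → Tensor F X Y Z} (hG : ∀ l, G l ≠ 0) (e : (Σ p, κ p) → Fin n)
    (he : Function.Injective e) :
    (piKron fun p => piKron fun j : κ p => G (e ⟨p, j⟩)).IsRestrictionOf (piKron G) := by
  classical
  choose x₀ y₀ z₀ h₀ using fun l => Tensor.exists_ne_zero (hG l)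
  let E : (Σ p, κ p) ⊕ ((Set.range e)ᶜ : Set (Fin n)) ≃ Fin n :=
    (Equiv.sumCongr (Equiv.ofInjective e he) (Equiv.refl _)).trans (Equiv.Set.sumCompl _)
  have hEl : ∀ q, E (Sum.inl q) = e q := fun q => by simp [E]
  have key : (piKron fun p => piKron fun j : κ p => G (e ⟨p, j⟩)) = fun x y z =>
      (∏ r : ((Set.range e)ᶜ : Set (Fin n)), (G r (x₀ r) (y₀ r) (z₀ r))⁻¹) * 1 * 1 *
      piKron G (fun l => Sum.elim (fun q => x q.1 q.2) (fun r => x₀ r.1) (E.symm l))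
        (fun l => Sum.elim (fun q => y q.1 q.2) (fun r => y₀ r.1) (E.symm l))
        (fun l => Sum.elim (fun q => z q.1 q.2) (fun r => z₀ r.1) (E.symm l)) := by
    funext x y z
    simp only [piKron]
    rw [← E.prod_comp, Fintype.prod_sum_type]
    simp only [Equiv.symm_apply_apply, Sum.elim_inl, Sum.elim_inr]
    have hr : ∀ r : ((Set.range e)ᶜ : Set (Fin n)), E (Sum.inr r) = r := fun r => by simp [E]
    simp only [hEl, hr, mul_one]
    rw [mul_comm, mul_assoc, ← Finset.prod_mul_distrib]
    simp only [mul_inv_cancel₀ (h₀ _), Finset.prod_const_one, mul_one, Fintype.prod_sigma]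
  rw [key]
  -- all scalars are moved to the first variable set
  exact isRestrictionOf_monomial (piKron G) _ _ _ (fun _ => _) (fun _ => 1) (fun _ => 1)

/-- A product of tensors `G s`, in which `s` occurs `t s` times, achieves the powers of what
the `N s`-th powers of the `G s` achieve. -/
theorem achieves_piKron_comp {X Y Z : Type*} [Fintype X] [Fintype Y] [Fintype Z] {τ : ℝ}
    {A : Type} [Fintype A] [DecidableEq A] {n : ℕ} (G : A → Tensor F X Y Z) (f : Fin n → A)
    (hG : ∀ l, G (f l) ≠ 0) (N : A → ℕ) (v : A → ℝ)
    (hv : ∀ l, Achieves τ ((G (f l)).kronPow (N (f l))) (v (f l))) :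
    Achieves τ (piKron fun l => G (f l)) (∏ s, v s ^ (letterCount f s / N s)) := by
  classical
  have emb : ∀ s, Nonempty (Fin (letterCount f s / N s) × Fin (N s) ↪ {l // f l = s}) := by
    intro s
    refine Function.Embedding.nonempty_of_card_le ?_
    rw [Fintype.card_prod, Fintype.card_fin, Fintype.card_fin, Fintype.card_subtype]
    exact Nat.div_mul_le_self _ _
  replace emb := fun s => (emb s).some
  -- each letter `s` contributes `letterCount f s / N s` groups of `N s` positions; the positions
  -- left over are filled with nonzero coefficients
  let e : (Σ p : (Σ s, Fin (letterCount f s / N s)), Fin (N p.1)) → Fin n :=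
    fun q => (emb q.1.1 (q.1.2, q.2)).1
  have hfe : ∀ q, f (e q) = q.1.1 := fun q => (emb q.1.1 (q.1.2, q.2)).2
  have he : Function.Injective e := by
    rintro ⟨⟨s, i⟩, j⟩ ⟨⟨s', i'⟩, j'⟩ h
    obtain rfl : s = s' := by
      have := congrArg f h
      rwa [hfe, hfe] at this
    have := (emb s).injective (Subtype.ext h)
    rw [Prod.mk.injEq] at this
    obtain ⟨rfl, rfl⟩ := this
    rfl
  refine Achieves.mono ?_ (piKron_sigma_isRestrictionOf hG e he)
  have hprod : ∏ s, v s ^ (letterCount f s / N s) =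
      ∏ p : (Σ s, Fin (letterCount f s / N s)), v p.1 := by
    rw [Fintype.prod_sigma]
    simp
  rw [hprod]
  refine achieves_piKron fun p => ?_
  simp only [hfe]
  obtain ⟨l, hl⟩ : ∃ l, f l = p.1 := by
    have hp := p.2.pos
    have : 0 < letterCount f p.1 := Nat.pos_of_ne_zero fun h => by simp [h] at hp
    obtain ⟨l, hl⟩ := Finset.card_pos.1 this
    exact ⟨l, (Finset.mem_filter.1 hl).2⟩
  have := hv l
  rwa [hl] at this

variable {X Y Z : Type*} {kX kY kZ n : ℕ}

/-- The block `T_{ijk}`, extended by zero to all variables. -/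
def BlockTensor.maskedBlock (T : BlockTensor F X Y Z kX kY kZ) (s : Fin kX × Fin kY × Fin kZ) :
    Tensor F X Y Z :=
  fun x y z => if T.partX x = s.1 ∧ T.partY y = s.2.1 ∧ T.partZ z = s.2.2 then
    T.tensor x y z else 0

/-- The symmetrized product `T ⊗ T'^r ⊗ T''^rr`. -/
def symProd (T T' T'' : Tensor F X Y Z) : Tensor F ((X × Y) × Z) ((Y × Z) × X) ((Z × X) × Y) :=
  (T.kron T'.rot).kron T''.rot.rot

theorem symProd_apply (T T' T'' : Tensor F X Y Z) (x : (X × Y) × Z) (y : (Y × Z) × X)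
    (z : (Z × X) × Y) : symProd T T' T'' x y z =
      T x.1.1 y.1.1 z.1.1 * T' z.1.2 x.1.2 y.1.2 * T'' y.2 z.2 x.2 := rfl

/-- The part of `(T ⊗ T^r ⊗ T^rr)^{⊗ n}` that belongs to a triple of sequences of blocks. -/
def BlockTensor.tripleBlock (T : BlockTensor F X Y Z kX kY kZ) (d : BlockTriple kX kY kZ n) :
    Tensor F (Fin n → (X × Y) × Z) (Fin n → (Y × Z) × X) (Fin n → (Z × X) × Y) :=
  piKron fun l => symProd (T.maskedBlock (d.1 l)) (T.maskedBlock (d.2.1 l))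
    (T.maskedBlock (d.2.2 l))

variable (T : BlockTensor F X Y Z kX kY kZ)

theorem BlockTensor.mem_nonzeroBlocks_of_ne_zero {x : X} {y : Y} {z : Z}
    (h : T.tensor x y z ≠ 0) : (T.partX x, T.partY y, T.partZ z) ∈ T.nonzeroBlocks := by
  classical
  simp only [BlockTensor.nonzeroBlocks, Finset.mem_filter, Finset.mem_univ, true_and]
  intro h0
  exact h (congrFun (congrFun (congrFun h0 ⟨x, rfl⟩) ⟨y, rfl⟩) ⟨z, rfl⟩)

theorem BlockTensor.maskedBlock_ne_zero {s : Fin kX × Fin kY × Fin kZ}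
    (hs : s ∈ T.nonzeroBlocks) : T.maskedBlock s ≠ 0 := by
  classical
  simp only [BlockTensor.nonzeroBlocks, Finset.mem_filter, Finset.mem_univ, true_and] at hs
  intro h0
  refine hs ?_
  funext x y z
  have := congrFun (congrFun (congrFun h0 x.1) y.1) z.1
  simp only [maskedBlock, x.2, y.2, z.2, and_self, if_true] at this
  exact this

theorem symProd_ne_zero {T T' T'' : Tensor F X Y Z} (h : T ≠ 0) (h' : T' ≠ 0) (h'' : T'' ≠ 0) :
    symProd T T' T'' ≠ 0 := by
  obtain ⟨x, y, z, h⟩ := Tensor.exists_ne_zero h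
  obtain ⟨x', y', z', h'⟩ := Tensor.exists_ne_zero h'
  obtain ⟨x'', y'', z'', h''⟩ := Tensor.exists_ne_zero h''
  intro h0
  have := congrFun (congrFun (congrFun h0 ((x, y'), z'')) ((y, z'), x'')) ((z, x'), y'')
  rw [symProd_apply] at this
  exact mul_ne_zero (mul_ne_zero h h') h'' this

theorem kronPow_ne_zero {T : Tensor F X Y Z} (h : T ≠ 0) (n : ℕ) : T.kronPow n ≠ 0 := by
  obtain ⟨x, y, z, h⟩ := Tensor.exists_ne_zero h
  intro h0
  have := congrFun (congrFun (congrFun h0 fun _ => x) fun _ => y) fun _ => z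
  exact Finset.prod_ne_zero_iff.2 (fun _ _ => h) this

variable [Fintype X] [Fintype Y] [Fintype Z]

/-- An induced matching of block triples turns a power of the symmetrized tensor into a direct sum:
keep only the variables whose labels occur in the matching. -/
theorem copySum_tripleBlock_isRestrictionOf (D : Finset (BlockTriple kX kY kZ n))
    (hD : ∀ e : BlockTriple kX kY kZ n,
      (∀ l, e.1 l ∈ T.nonzeroBlocks ∧ e.2.1 l ∈ T.nonzeroBlocks ∧ e.2.2 l ∈ T.nonzeroBlocks) →
      ∀ d₁ ∈ D, ∀ d₂ ∈ D, ∀ d₃ ∈ D, labelX e = labelX d₁ → labelY e = labelY d₂ →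
        labelZ e = labelZ d₃ → d₁ = d₂ ∧ d₁ = d₃) :
    (copySum fun d : D => T.tripleBlock d.1).IsRestrictionOf
      ((symProd T.tensor T.tensor T.tensor).kronPow n) := by
  classical
  let e : (Fin n → (X × Y) × Z) → (Fin n → (Y × Z) × X) → (Fin n → (Z × X) × Y) →
      BlockTriple kX kY kZ n := fun x y z =>
    (fun l => (T.partX (x l).1.1, T.partY (y l).1.1, T.partZ (z l).1.1),
      fun l => (T.partX (z l).1.2, T.partY (x l).1.2, T.partZ (y l).1.2),
      fun l => (T.partX (y l).2, T.partY (z l).2, T.partZ (x l).2))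
  let lX : (Fin n → (X × Y) × Z) → (Fin n → Fin kX) × (Fin n → Fin kY) × (Fin n → Fin kZ) :=
    fun x => (fun l => T.partX (x l).1.1, fun l => T.partY (x l).1.2, fun l => T.partZ (x l).2)
  let lY : (Fin n → (Y × Z) × X) → (Fin n → Fin kY) × (Fin n → Fin kZ) × (Fin n → Fin kX) :=
    fun y => (fun l => T.partY (y l).1.1, fun l => T.partZ (y l).1.2, fun l => T.partX (y l).2)
  let lZ : (Fin n → (Z × X) × Y) → (Fin n → Fin kZ) × (Fin n → Fin kX) × (Fin n → Fin kY) :=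
    fun z => (fun l => T.partZ (z l).1.1, fun l => T.partX (z l).1.2, fun l => T.partY (z l).2)
  -- `e x y z` is the block of the three variables, and `lX x`, `lY y`, `lZ z` are its labels
  have key : (copySum fun d : D => T.tripleBlock d.1) = fun x y z =>
      (if lX x.2 = labelX x.1.1 then 1 else 0) * (if lY y.2 = labelY y.1.1 then 1 else 0) *
        (if lZ z.2 = labelZ z.1.1 then 1 else 0) *
        (symProd T.tensor T.tensor T.tensor).kronPow n x.2 y.2 z.2 := by
    funext ⟨d₁, x⟩ ⟨d₂, y⟩ ⟨d₃, z⟩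
    have hblock : ∀ d : BlockTriple kX kY kZ n, T.tripleBlock d x y z =
        if lX x = labelX d ∧ lY y = labelY d ∧ lZ z = labelZ d then
          (symProd T.tensor T.tensor T.tensor).kronPow n x y z else 0 := by
      intro d
      split_ifs with h
      · obtain ⟨h1, h2, h3⟩ := h
        simp only [lX, lY, lZ, labelX, labelY, labelZ, Prod.mk.injEq, funext_iff] at h1 h2 h3
        simp only [BlockTensor.tripleBlock, piKron, Tensor.kronPow]
        refine Finset.prod_congr rfl fun l _ => ?_
        simp only [symProd_apply, BlockTensor.maskedBlock]
        rw [if_pos ⟨h1.1 l, h2.1 l, h3.1 l⟩, if_pos ⟨h3.2.1 l, h1.2.1 l, h2.2.1 l⟩,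
          if_pos ⟨h2.2.2 l, h3.2.2 l, h1.2.2 l⟩]
      · by_contra hne
        simp only [BlockTensor.tripleBlock, piKron] at hne
        have hl : ∀ l, symProd (T.maskedBlock (d.1 l)) (T.maskedBlock (d.2.1 l))
            (T.maskedBlock (d.2.2 l)) (x l) (y l) (z l) ≠ 0 := fun l =>
          Finset.prod_ne_zero_iff.1 hne l (Finset.mem_univ l)
        simp only [symProd_apply, BlockTensor.maskedBlock, mul_ne_zero_iff, ne_eq,
          ite_eq_right_iff, Classical.not_imp] at hl
        refine h ⟨?_, ?_, ?_⟩
        · exact Prod.ext (funext fun l => (hl l).1.1.1.1) (Prod.ext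
            (funext fun l => (hl l).1.2.1.2.1) (funext fun l => (hl l).2.1.2.2))
        · exact Prod.ext (funext fun l => (hl l).1.1.1.2.1) (Prod.ext
            (funext fun l => (hl l).1.2.1.2.2) (funext fun l => (hl l).2.1.1))
        · exact Prod.ext (funext fun l => (hl l).1.1.1.2.2) (Prod.ext
            (funext fun l => (hl l).1.2.1.1) (funext fun l => (hl l).2.1.2.1))
    simp only [copySum, hblock]
    by_cases h1 : lX x = labelX d₁.1
    swap
    · simp [h1]
    by_cases hd : d₂ = d₁ ∧ d₃ = d₁
    · obtain ⟨rfl, rfl⟩ := hd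
      by_cases h2 : lY y = labelY d₃.1
      swap
      · simp [h2]
      by_cases h3 : lZ z = labelZ d₃.1
      swap
      · simp [h3]
      simp [h1, h2, h3]
    · rw [if_neg hd]
      by_cases h2 : lY y = labelY d₂.1
      swap
      · simp [h2]
      by_cases h3 : lZ z = labelZ d₃.1
      swap
      · simp [h3]
      suffices h0 : (symProd T.tensor T.tensor T.tensor).kronPow n x y z = 0 by rw [h0, mul_zero]
      by_contra hne
      have hl : ∀ l, symProd T.tensor T.tensor T.tensor (x l) (y l) (z l) ≠ 0 := fun l =>
        Finset.prod_ne_zero_iff.1 hne l (Finset.mem_univ l)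
      simp only [symProd_apply, mul_ne_zero_iff] at hl
      obtain ⟨e1, e2⟩ := hD (e x y z) (fun l => ⟨T.mem_nonzeroBlocks_of_ne_zero (hl l).1.1,
        T.mem_nonzeroBlocks_of_ne_zero (hl l).1.2, T.mem_nonzeroBlocks_of_ne_zero (hl l).2⟩)
        d₁.1 d₁.2 d₂.1 d₂.2 d₃.1 d₃.2 h1 h2 h3
      exact hd ⟨Subtype.ext e1.symm, Subtype.ext e2.symm⟩
  rw [key]
  exact isRestrictionOf_monomial _ Prod.snd Prod.snd Prod.snd _ _ _

/-- If the three sequences have the same type, then permuting the factors of the three parts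
independently aligns them. -/
theorem piKron_symProd_isRestrictionOf {t : Fin kX × Fin kY × Fin kZ → ℕ}
    {d : BlockTriple kX kY kZ n} (hd : d ∈ typeClass n t ×ˢ typeClass n t ×ˢ typeClass n t) :
    (piKron fun l => symProd (T.maskedBlock (d.1 l)) (T.maskedBlock (d.1 l))
      (T.maskedBlock (d.1 l))).IsRestrictionOf (T.tripleBlock d) := by
  simp only [Finset.mem_product, mem_typeClass] at hd
  obtain ⟨σ, hσ⟩ := exists_perm_of_letterCount_eq (hd.1.trans hd.2.1.symm)
  obtain ⟨ρ, hρ⟩ := exists_perm_of_letterCount_eq (hd.1.trans hd.2.2.symm)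
  have key : (piKron fun l => symProd (T.maskedBlock (d.1 l)) (T.maskedBlock (d.1 l))
      (T.maskedBlock (d.1 l))) = fun x y z => T.tripleBlock d
      (fun l => (((x l).1.1, (x (σ.symm l)).1.2), (x (ρ.symm l)).2))
      (fun l => (((y l).1.1, (y (σ.symm l)).1.2), (y (ρ.symm l)).2))
      (fun l => (((z l).1.1, (z (σ.symm l)).1.2), (z (ρ.symm l)).2)) := by
    funext x y z
    simp only [piKron, BlockTensor.tripleBlock, symProd_apply, Finset.prod_mul_distrib]
    congr 1
    · congr 1
      refine Eq.trans ?_ (Equiv.prod_comp σ _)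
      simp only [hσ, Equiv.symm_apply_apply]
    · refine Eq.trans ?_ (Equiv.prod_comp ρ _)
      simp only [hρ, Equiv.symm_apply_apply]
  rw [key]
  exact isRestrictionOf_comp _ _ _ _

theorem kronPow_block_isRestrictionOf (s : Fin kX × Fin kY × Fin kZ) (N : ℕ) :
    ((symProd (T.block s.1 s.2.1 s.2.2) (T.block s.1 s.2.1 s.2.2)
      (T.block s.1 s.2.1 s.2.2)).kronPow N).IsRestrictionOf
      ((symProd (T.maskedBlock s) (T.maskedBlock s) (T.maskedBlock s)).kronPow N) := by
  have hb : T.block s.1 s.2.1 s.2.2 = fun x y z => T.maskedBlock s x.1 y.1 z.1 := by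
    funext x y z
    simp [BlockTensor.block, BlockTensor.maskedBlock, x.2, y.2, z.2]
  rw [hb]
  exact isRestrictionOf_comp ((symProd (T.maskedBlock s) (T.maskedBlock s)
    (T.maskedBlock s)).kronPow N)
    (fun (w : Fin N → ({x // T.partX x = s.1} × {y // T.partY y = s.2.1}) ×
        {z // T.partZ z = s.2.2}) l => (((w l).1.1.1, (w l).1.2.1), (w l).2.1))
    (fun (w : Fin N → ({y // T.partY y = s.2.1} × {z // T.partZ z = s.2.2}) ×
        {x // T.partX x = s.1}) l => (((w l).1.1.1, (w l).1.2.1), (w l).2.1))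
    (fun (w : Fin N → ({z // T.partZ z = s.2.2} × {x // T.partX x = s.1}) ×
        {y // T.partY y = s.2.1}) l => (((w l).1.1.1, (w l).1.2.1), (w l).2.1))

/-- What an induced matching of block triples of a given type achieves. -/
theorem achieves_of_matching {τ : ℝ} {t : Fin kX × Fin kY × Fin kZ → ℕ}
    (hletters : ∀ f ∈ typeClass n t, ∀ l, f l ∈ T.nonzeroBlocks)
    (D : Finset (BlockTriple kX kY kZ n))
    (hDt : D ⊆ typeClass n t ×ˢ typeClass n t ×ˢ typeClass n t)
    (hD : ∀ e : BlockTriple kX kY kZ n,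
      (∀ l, e.1 l ∈ T.nonzeroBlocks ∧ e.2.1 l ∈ T.nonzeroBlocks ∧ e.2.2 l ∈ T.nonzeroBlocks) →
      ∀ d₁ ∈ D, ∀ d₂ ∈ D, ∀ d₃ ∈ D, labelX e = labelX d₁ → labelY e = labelY d₂ →
        labelZ e = labelZ d₃ → d₁ = d₂ ∧ d₁ = d₃)
    (N : Fin kX × Fin kY × Fin kZ → ℕ) (v : Fin kX × Fin kY × Fin kZ → ℝ)
    (hv : ∀ s ∈ T.nonzeroBlocks, Achieves τ ((symProd (T.block s.1 s.2.1 s.2.2)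
      (T.block s.1 s.2.1 s.2.2) (T.block s.1 s.2.1 s.2.2)).kronPow (N s)) (v s)) :
    Achieves τ ((symProd T.tensor T.tensor T.tensor).kronPow n)
      (D.card * ∏ s, v s ^ (t s / N s)) := by
  have h := (achieves_copySum (τ := τ) (U := fun d : D => T.tripleBlock d.1)
    (v := fun _ => ∏ s, v s ^ (t s / N s)) fun d => ?_).mono
      (copySum_tripleBlock_isRestrictionOf T D hD)
  · simpa using h
  · have hd := hDt d.2
    have hd1 := (Finset.mem_product.1 hd).1
    refine Achieves.mono ?_ (piKron_symProd_isRestrictionOf T hd)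
    have := achieves_piKron_comp (τ := τ)
      (fun s => symProd (T.maskedBlock s) (T.maskedBlock s) (T.maskedBlock s)) d.1.1
      (fun l => ?_) N v fun l => ?_
    · rwa [mem_typeClass.1 hd1] at this
    · have := T.maskedBlock_ne_zero (hletters _ hd1 l)
      exact symProd_ne_zero this this this
    · exact (hv _ (hletters _ hd1 l)).mono (kronPow_block_isRestrictionOf T _ _)

end Blocks

/-! ### The value of a partitioned tensor -/

section Value

variable {F : Type*} [Field F] {X Y Z : Type*} {kX kY kZ : ℕ}

theorem marginal_fst (α : Fin kX × Fin kY × Fin kZ → ℝ) :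
    marginal (fun s => s.1) α = margX α := by
  funext i
  simp only [marginal, margX, Fintype.sum_prod_type]
  rw [Finset.sum_eq_single i (fun b _ hb => by simp [hb]) (by simp)]
  simp

theorem marginal_snd (α : Fin kX × Fin kY × Fin kZ → ℝ) :
    marginal (fun s => s.2.1) α = margY α := by
  funext j
  simp only [marginal, margY, Fintype.sum_prod_type]
  refine Finset.sum_congr rfl fun i _ => ?_
  rw [Finset.sum_eq_single j (fun b _ hb => by simp [hb]) (by simp)]
  simp

theorem marginal_thd (α : Fin kX × Fin kY × Fin kZ → ℝ) :
    marginal (fun s => s.2.2) α = margZ α := by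
  funext k
  simp only [marginal, margZ, Fintype.sum_prod_type]
  simp

theorem rpow_neg_self_eq_exp {x : ℝ} (hx : 0 ≤ x) : x ^ (-x) = Real.exp (Real.negMulLog x) := by
  rcases hx.eq_or_lt with rfl | hx
  · simp
  · rw [Real.rpow_def_of_pos hx, Real.negMulLog]
    congr 1
    ring

theorem prod_rpow_neg_self {A : Type*} [Fintype A] {β : A → ℝ} (h0 : ∀ s, 0 ≤ β s) :
    ∏ s, β s ^ (-β s) = Real.exp (entropy β) := by
  rw [entropy, Real.exp_sum]
  exact Finset.prod_congr rfl fun s _ => rpow_neg_self_eq_exp (h0 s)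

theorem BlockTensor.alphaN_eq_exp (T : BlockTensor F X Y Z kX kY kZ)
    {β : Fin kX × Fin kY × Fin kZ → ℝ} (hβ : β ∈ T.distributions) :
    T.alphaN β = Real.exp (entropy β) := by
  rw [← prod_rpow_neg_self fun s => (hβ.1 s).1, BlockTensor.alphaN]
  refine Finset.prod_subset (Finset.subset_univ _) fun s _ hs => ?_
  rw [hβ.2.1 s hs]
  simp

theorem margX_nonneg {α : Fin kX × Fin kY × Fin kZ → ℝ} (h : ∀ s, 0 ≤ α s) (i : Fin kX) :
    0 ≤ margX α i := Finset.sum_nonneg fun _ _ => Finset.sum_nonneg fun _ _ => h _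

theorem margY_nonneg {α : Fin kX × Fin kY × Fin kZ → ℝ} (h : ∀ s, 0 ≤ α s) (j : Fin kY) :
    0 ≤ margY α j := Finset.sum_nonneg fun _ _ => Finset.sum_nonneg fun _ _ => h _

theorem margZ_nonneg {α : Fin kX × Fin kY × Fin kZ → ℝ} (h : ∀ s, 0 ≤ α s) (k : Fin kZ) :
    0 ≤ margZ α k := Finset.sum_nonneg fun _ _ => Finset.sum_nonneg fun _ _ => h _

theorem alphaB_eq_exp {α : Fin kX × Fin kY × Fin kZ → ℝ} (h : ∀ s, 0 ≤ α s) :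
    alphaB α = Real.exp ((entropy (margX α) + entropy (margY α) + entropy (margZ α)) / 3) := by
  rw [alphaB, prod_rpow_neg_self (margX_nonneg h), prod_rpow_neg_self (margY_nonneg h),
    prod_rpow_neg_self (margZ_nonneg h), ← Real.exp_mul, ← Real.exp_mul, ← Real.exp_mul,
    ← Real.exp_add, ← Real.exp_add]
  congr 1
  ring

theorem BlockTensor.sum_eq_one (T : BlockTensor F X Y Z kX kY kZ)
    {β : Fin kX × Fin kY × Fin kZ → ℝ} (hβ : β ∈ T.distributions) : ∑ s, β s = 1 := by
  rw [← hβ.2.2]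
  exact (Finset.sum_subset (Finset.subset_univ _) fun s _ hs => hβ.2.1 s hs).symm

theorem BlockTensor.mem_distributions (T : BlockTensor F X Y Z kX kY kZ)
    {β : Fin kX × Fin kY × Fin kZ → ℝ} (h0 : ∀ s, 0 ≤ β s) (h1 : ∑ s, β s = 1)
    (h : ∀ s ∉ T.nonzeroBlocks, β s = 0) : β ∈ T.distributions := by
  refine ⟨fun s => ⟨h0 s, ?_⟩, h, ?_⟩
  · rw [← h1]
    exact Finset.single_le_sum (fun i _ => h0 i) (Finset.mem_univ s)
  · rw [← h1]
    exact Finset.sum_subset (Finset.subset_univ _) fun s _ hs => h s hs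

/-- The maximum of `β_N` over the distributions with given marginals exists. -/
theorem BlockTensor.exists_isGreatest_alphaN (T : BlockTensor F X Y Z kX kY kZ)
    {α : Fin kX × Fin kY × Fin kZ → ℝ} (hα : α ∈ T.distributions) :
    ∃ γ ∈ T.sameMarginals α, ∀ β ∈ T.sameMarginals α, entropy β ≤ entropy γ := by
  have hcompact : IsCompact (T.sameMarginals α) := by
    refine (isCompact_distributions T.nonzeroBlocks).of_isClosed_subset ?_ fun β hβ =>
      ⟨fun s => (hβ.1.1 s).1, T.sum_eq_one hβ.1, hβ.1.2.1⟩
    have hset : T.sameMarginals α =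
        {β : Fin kX × Fin kY × Fin kZ → ℝ | (∀ s, 0 ≤ β s) ∧ ∑ s, β s = 1 ∧
          ∀ s ∉ T.nonzeroBlocks, β s = 0} ∩
        {β | margX α = margX β} ∩ {β | margY α = margY β} ∩ {β | margZ α = margZ β} := by
      ext β
      constructor
      · rintro ⟨h, h1, h2, h3⟩
        exact ⟨⟨⟨⟨fun s => (h.1 s).1, T.sum_eq_one h, h.2.1⟩, funext h1⟩, funext h2⟩, funext h3⟩
      · rintro ⟨⟨⟨h, h1⟩, h2⟩, h3⟩
        exact ⟨T.mem_distributions h.1 h.2.1 h.2.2, congrFun h1, congrFun h2, congrFun h3⟩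
    rw [hset]
    refine (((isCompact_distributions _).isClosed.inter ?_).inter ?_).inter ?_
    · simp only [← marginal_fst]
      exact isClosed_eq continuous_const (continuous_marginal _)
    · simp only [← marginal_snd]
      exact isClosed_eq continuous_const (continuous_marginal _)
    · simp only [← marginal_thd]
      exact isClosed_eq continuous_const (continuous_marginal _)
  obtain ⟨γ, hγ, h⟩ := hcompact.exists_isMaxOn
    ⟨α, hα, fun _ => rfl, fun _ => rfl, fun _ => rfl⟩ continuous_entropy.continuousOn
  exact ⟨γ, hγ, fun β hβ => h hβ⟩

variable [Fintype X] [Fintype Y] [Fintype Z]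

/-- Numerical form of the lower bound: `t` occurrences of a factor, grouped into `t / N` blocks of
length `N`, lose at most one block. -/
theorem mul_log_le_div_mul_log {t N : ℕ} (hN : 0 < N) {c v : ℝ} (hc : 1 ≤ c)
    (hv : c ^ (3 * N) ≤ v) :
    3 * (t * Real.log c - N * Real.log c) ≤ ((t / N : ℕ) : ℝ) * Real.log v := by
  have hlog : 0 ≤ Real.log c := Real.log_nonneg hc
  have h1 : ((3 * N : ℕ) : ℝ) * Real.log c ≤ Real.log v := by
    rw [← Real.log_pow]
    exact Real.log_le_log (by positivity) hv
  have h2 : (t : ℝ) ≤ (t / N : ℕ) * N + N := by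
    have h3 := Nat.div_add_mod t N
    have h4 := Nat.mod_lt t hN
    have : t ≤ t / N * N + N := by
      rw [mul_comm (t / N) N]
      omega
    exact_mod_cast this
  calc 3 * (t * Real.log c - N * Real.log c) = 3 * ((t - N) * Real.log c) := by ring
    _ ≤ 3 * (((t / N : ℕ) * N : ℝ) * Real.log c) := by
        gcongr
        linarith
    _ = (t / N : ℕ) * (((3 * N : ℕ) : ℝ) * Real.log c) := by push_cast; ring
    _ ≤ _ := by gcongr

/-- The lower bound for the value, given lower bounds `c s` for the values of the blocks. -/
theorem BlockTensor.ofReal_exp_le_value {P : ℤ} (T : BlockTensor F X Y Z kX kY kZ)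
    (hT : T.IsPartitioned P) {α : Fin kX × Fin kY × Fin kZ → ℝ} (hα : α ∈ T.distributions)
    {τ h : ℝ} (hmax : ∀ β ∈ T.sameMarginals α, entropy β ≤ h)
    (N : Fin kX × Fin kY × Fin kZ → ℕ) (v c : Fin kX × Fin kY × Fin kZ → ℝ)
    (hN : ∀ s, 0 < N s) (hc : ∀ s, 1 ≤ c s) (hcv : ∀ s, c s ^ (3 * N s) ≤ v s)
    (hv : ∀ s ∈ T.nonzeroBlocks, Achieves τ ((symProd (T.block s.1 s.2.1 s.2.2)
      (T.block s.1 s.2.1 s.2.2) (T.block s.1 s.2.1 s.2.2)).kronPow (N s)) (v s)) :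
    ENNReal.ofReal (Real.exp (∑ s, α s * Real.log (c s) +
      (entropy (margX α) + entropy (margY α) + entropy (margZ α)) / 3 +
      (entropy α - h) / 2)) ≤ value τ T.tensor := by
  set E := ∑ s, α s * Real.log (c s) +
      (entropy (margX α) + entropy (margY α) + entropy (margZ α)) / 3 +
      (entropy α - h) / 2 with hE
  set Λ := ∑ s, Real.log (c s) with hΛ
  have hΛ0 : 0 ≤ Λ := Finset.sum_nonneg fun s _ => Real.log_nonneg (hc s)
  set B := ∑ s, N s * Real.log (c s) with hB
  have key : ∀ δ > 0, ENNReal.ofReal (Real.exp (E - δ * (1 + Λ))) ≤ value τ T.tensor := by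
    intro δ hδ
    obtain ⟨n, hn, hn0, t, ht, hletters, D, hDt, hDne, hD, hDlog⟩ :=
      exists_large_matching (P := P) (S := T.nonzeroBlocks) (h := h) hT
        (fun s => (hα.1 s).1) (T.sum_eq_one hα) hα.2.1
        (fun β b0 b1 bs bX bY bZ => hmax β ⟨T.mem_distributions b0 b1 bs,
          fun i => by rw [← marginal_fst, ← marginal_fst, bX],
          fun i => by rw [← marginal_snd, ← marginal_snd, bY],
          fun i => by rw [← marginal_thd, ← marginal_thd, bZ]⟩) hδ ⌈3 * B / δ⌉₊
    rw [marginal_fst, marginal_snd, marginal_thd] at hDlog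
    have hach := achieves_of_matching T hletters D hDt hD N v hv
    refine le_trans (ENNReal.ofReal_le_ofReal ?_) (hach.le_value hn0)
    have hnR : (0 : ℝ) < n := by exact_mod_cast hn0
    have hD0 : (0 : ℝ) < D.card := by exact_mod_cast Finset.card_pos.2 hDne
    have hv0 : ∀ s, 0 < v s := fun s =>
      lt_of_lt_of_le (pow_pos (zero_lt_one.trans_le (hc s)) _) (hcv s)
    have hprod : 0 < ∏ s, v s ^ (t s / N s) := Finset.prod_pos fun s _ => pow_pos (hv0 s) _
    have hBn : 3 * B ≤ δ * n := by
      rw [← div_le_iff₀' hδ]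
      exact (Nat.le_ceil _).trans (by exact_mod_cast hn)
    have hlog : 3 * (n * ∑ s, α s * Real.log (c s) - δ * n * Λ - B) ≤
        Real.log (∏ s, v s ^ (t s / N s)) := by
      rw [Real.log_prod fun s _ => (pow_pos (hv0 s) _).ne']
      calc 3 * (n * ∑ s, α s * Real.log (c s) - δ * n * Λ - B) =
          ∑ s, 3 * ((n * α s - δ * n) * Real.log (c s) - N s * Real.log (c s)) := by
            rw [hΛ, hB, Finset.mul_sum, Finset.mul_sum, ← Finset.sum_sub_distrib,
              ← Finset.sum_sub_distrib, Finset.mul_sum]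
            exact Finset.sum_congr rfl fun s _ => by ring
        _ ≤ _ := by
            refine Finset.sum_le_sum fun s _ => ?_
            rw [Real.log_pow]
            refine le_trans ?_ (mul_log_le_div_mul_log (t := t s) (hN s) (hc s) (hcv s))
            have h1 := (abs_le.1 (ht s)).1
            have h2 : (n * α s - δ * n) * Real.log (c s) ≤ t s * Real.log (c s) :=
              mul_le_mul_of_nonneg_right (by linarith) (Real.log_nonneg (hc s))
            linarith
    rw [Real.rpow_def_of_pos (mul_pos hD0 hprod), Real.log_mul hD0.ne' hprod.ne',
      Real.exp_le_exp, mul_one_div, le_div_iff₀ (by positivity), hE]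
    have hδn := mul_pos hδ hnR
    linarith
  have hlim : Filter.Tendsto (fun δ : ℝ => ENNReal.ofReal (Real.exp (E - δ * (1 + Λ))))
      (nhdsWithin 0 (Set.Ioi 0)) (nhds (ENNReal.ofReal (Real.exp E))) := by
    have hcont : Continuous fun δ : ℝ => ENNReal.ofReal (Real.exp (E - δ * (1 + Λ))) :=
      ENNReal.continuous_ofReal.comp (by fun_prop)
    have := (hcont.tendsto 0).mono_left (nhdsWithin_le_nhds (s := Set.Ioi 0))
    simpa using this
  exact le_of_tendsto hlim (Filter.eventually_of_mem self_mem_nhdsWithin fun δ hδ => key δ hδ)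

/-- The value of a nonzero tensor is the limit of numbers `c k ≥ 1` whose powers are achieved. -/
theorem exists_seq_tendsto_value (τ : ℝ) {T : Tensor F X Y Z} (hT : T ≠ 0) :
    ∃ (N : ℕ → ℕ) (v c : ℕ → ℝ), (∀ k, 0 < N k) ∧ (∀ k, 1 ≤ c k) ∧
      (∀ k, c k ^ (3 * N k) ≤ v k) ∧ (∀ k, Achieves τ ((symProd T T T).kronPow (N k)) (v k)) ∧
      Filter.Tendsto (fun k => ENNReal.ofReal (c k)) Filter.atTop (nhds (value τ T)) := by
  have hone : ∀ n, Achieves τ ((symProd T T T).kronPow n) 1 := fun n =>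
    achieves_one (kronPow_ne_zero (symProd_ne_zero hT hT hT) n)
  have h1 : 1 ≤ value τ T := by
    have := (hone 1).le_value one_pos
    rwa [Real.one_rpow, ENNReal.ofReal_one] at this
  obtain ⟨u, -, hu, hmem⟩ := exists_seq_tendsto_sSup (S := {v : ENNReal | ∃ (n m : ℕ)
      (a b c : Fin m → ℕ), 0 < n ∧ (∀ i, 0 < a i ∧ 0 < b i ∧ 0 < c i) ∧
      (directSum fun i => matMul F (a i) (b i) (c i)).IsRestrictionOf
        (((T.kron T.rot).kron T.rot.rot).kronPow n) ∧
      v = ENNReal.ofReal ((∑ i, ((a i * b i * c i : ℕ) : ℝ) ^ τ) ^ (1 / (3 * (n : ℝ))))})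
    (by
      obtain ⟨m, a, b, c, hpos, hr, -⟩ := (hone 1).exists_directSum
      exact ⟨_, 1, m, a, b, c, one_pos, hpos, hr, rfl⟩) (OrderTop.bddAbove _)
  change Filter.Tendsto u Filter.atTop (nhds (value τ T)) at hu
  have hdata : ∀ k, ∃ (N : ℕ) (v c : ℝ), 0 < N ∧ 1 ≤ c ∧ c ^ (3 * N) ≤ v ∧
      Achieves τ ((symProd T T T).kronPow N) v ∧ ENNReal.ofReal c = max (u k) 1 := by
    intro k
    obtain ⟨n, m, a, b, c, hn, hpos, hr, huk⟩ := hmem k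
    have hach := achieves_of_directSum (τ := τ) hpos hr
    set w := ∑ i, ((a i * b i * c i : ℕ) : ℝ) ^ τ
    rcases le_total 1 (w ^ (1 / (3 * (n : ℝ)))) with hle | hle
    · refine ⟨n, w, w ^ (1 / (3 * (n : ℝ))), hn, hle, ?_, hach, ?_⟩
      · rw [← Real.rpow_natCast, ← Real.rpow_mul hach.nonneg]
        push_cast
        rw [one_div_mul_cancel (by positivity), Real.rpow_one]
      · rw [huk, max_eq_left]
        rw [← ENNReal.ofReal_one]
        exact ENNReal.ofReal_le_ofReal hle
    · refine ⟨1, 1, 1, one_pos, le_rfl, by simp, hone 1, ?_⟩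
      rw [huk, max_eq_right, ENNReal.ofReal_one]
      rw [← ENNReal.ofReal_one]
      exact ENNReal.ofReal_le_ofReal hle
  choose N v c hN hc hcv hach hmaxu using hdata
  refine ⟨N, v, c, hN, hc, hcv, hach, ?_⟩
  simp only [hmaxu]
  have := hu.max (tendsto_const_nhds (x := (1 : ENNReal)))
  rwa [max_eq_left h1] at this

theorem tendsto_prod_of_one_le {ι : Type*} (S : Finset ι) {f : ι → ℕ → ENNReal} {a : ι → ENNReal}
    (h : ∀ s ∈ S, Filter.Tendsto (f s) Filter.atTop (nhds (a s))) (ha : ∀ s ∈ S, a s ≠ 0) :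
    Filter.Tendsto (fun k => ∏ s ∈ S, f s k) Filter.atTop (nhds (∏ s ∈ S, a s)) := by
  classical
  induction S using Finset.induction_on with
  | empty => simp
  | insert s S hs ih =>
    simp only [Finset.prod_insert hs]
    refine ENNReal.Tendsto.mul (h s (Finset.mem_insert_self s S))
      (Or.inl (ha s (Finset.mem_insert_self s S)))
      (ih (fun r hr => h r (Finset.mem_insert_of_mem hr))
        fun r hr => ha r (Finset.mem_insert_of_mem hr)) (Or.inl ?_)
    exact Finset.prod_ne_zero_iff.2 fun r hr => ha r (Finset.mem_insert_of_mem hr)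

end Value

end RefinedLaser

open RefinedLaser in
theorem theorem4p1 {F X Y Z : Type*} [Field F] [Fintype X] [Fintype Y] [Fintype Z]
    {kX kY kZ : ℕ} (P : ℤ) (T : RefinedLaser.BlockTensor F X Y Z kX kY kZ)
    (hT : T.IsPartitioned P) (α : Fin kX × Fin kY × Fin kZ → ℝ) (hα : α ∈ T.distributions)
    (τ : ℝ) (hτ : τ ∈ Set.Icc (2 / 3 : ℝ) 1) :
    ∃ N : ℝ, IsGreatest (T.alphaN '' T.sameMarginals α) N ∧
      T.alphaV τ α *
          ENNReal.ofReal (RefinedLaser.alphaB α * Real.sqrt (T.alphaN α / N)) ≤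
        RefinedLaser.value τ T.tensor := by
  classical
  obtain ⟨γ, hγ, hmax⟩ := T.exists_isGreatest_alphaN hα
  refine ⟨T.alphaN γ, ⟨⟨γ, hγ, rfl⟩, ?_⟩, ?_⟩
  · rintro _ ⟨β, hβ, rfl⟩
    rw [T.alphaN_eq_exp hβ.1, T.alphaN_eq_exp hγ.1]
    exact Real.exp_le_exp.2 (hmax β hβ)
  have hblock : ∀ s ∈ T.nonzeroBlocks, T.block s.1 s.2.1 s.2.2 ≠ 0 := fun s hs => by
    simpa [BlockTensor.nonzeroBlocks] using hs
  have hdata : ∀ s, ∃ (N : ℕ → ℕ) (v c : ℕ → ℝ), (∀ k, 0 < N k) ∧ (∀ k, 1 ≤ c k) ∧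
      (∀ k, c k ^ (3 * N k) ≤ v k) ∧ (s ∈ T.nonzeroBlocks →
        (∀ k, Achieves τ ((symProd (T.block s.1 s.2.1 s.2.2) (T.block s.1 s.2.1 s.2.2)
          (T.block s.1 s.2.1 s.2.2)).kronPow (N k)) (v k)) ∧
        Filter.Tendsto (fun k => ENNReal.ofReal (c k)) Filter.atTop
          (nhds (value τ (T.block s.1 s.2.1 s.2.2)))) := by
    intro s
    by_cases hs : s ∈ T.nonzeroBlocks
    · obtain ⟨N, v, c, h1, h2, h3, h4, h5⟩ := exists_seq_tendsto_value τ (hblock s hs)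
      exact ⟨N, v, c, h1, h2, h3, fun _ => ⟨h4, h5⟩⟩
    · exact ⟨fun _ => 1, fun _ => 1, fun _ => 1, fun _ => one_pos, fun _ => le_rfl,
        fun _ => by simp, fun h => absurd h hs⟩
  choose N v c hN hc hcv hlim using hdata
  have hval : ∀ s ∈ T.nonzeroBlocks, 1 ≤ value τ (T.block s.1 s.2.1 s.2.2) := fun s hs =>
    ge_of_tendsto' (hlim s hs).2 fun k => by
      rw [← ENNReal.ofReal_one]
      exact ENNReal.ofReal_le_ofReal (hc s k)
  have hα0 : ∀ s, 0 ≤ α s := fun s => (hα.1 s).1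
  set E := (entropy (margX α) + entropy (margY α) + entropy (margZ α)) / 3 +
    (entropy α - entropy γ) / 2 with hE
  have hfactor : alphaB α * Real.sqrt (T.alphaN α / T.alphaN γ) = Real.exp E := by
    rw [alphaB_eq_exp hα0, T.alphaN_eq_exp hα, T.alphaN_eq_exp hγ.1, ← Real.exp_sub,
      Real.sqrt_eq_rpow, ← Real.exp_mul, ← Real.exp_add, hE]
    congr 1
    ring
  rw [hfactor]
  clear_value E
  have htend : Filter.Tendsto (fun k => (∏ s ∈ T.nonzeroBlocks, ENNReal.ofReal (c s k) ^ α s) *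
      ENNReal.ofReal (Real.exp E)) Filter.atTop
      (nhds (T.alphaV τ α * ENNReal.ofReal (Real.exp E))) := by
    refine ENNReal.Tendsto.mul_const (tendsto_prod_of_one_le _ (fun s hs => ?_) fun s hs => ?_)
      (Or.inr ENNReal.ofReal_ne_top)
    · exact ((ENNReal.continuous_rpow_const).tendsto _).comp (hlim s hs).2
    · have h1 := ENNReal.rpow_le_rpow (hval s hs) (hα0 s)
      rw [ENNReal.one_rpow] at h1
      exact (lt_of_lt_of_le one_pos h1).ne'
  refine le_of_tendsto' htend fun k => ?_
  refine le_trans (le_of_eq ?_) (T.ofReal_exp_le_value hT hα hmax (fun s => N s k)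
    (fun s => v s k) (fun s => c s k) (fun s => hN s k) (fun s => hc s k) (fun s => hcv s k)
    fun s hs => (hlim s hs).1 k)
  rw [add_assoc, ← hE, Real.exp_add, ENNReal.ofReal_mul (Real.exp_pos _).le, Real.exp_sum,
    ENNReal.ofReal_prod_of_nonneg fun s _ => (Real.exp_pos _).le]
  congr 1
  have hpow : ∀ s, ENNReal.ofReal (Real.exp (α s * Real.log (c s k))) =
      ENNReal.ofReal (c s k) ^ α s := by
    intro s
    have hpos : 0 < c s k := zero_lt_one.trans_le (hc s k)
    rw [ENNReal.ofReal_rpow_of_pos hpos, Real.rpow_def_of_pos hpos, mul_comm]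
  simp only [hpow]
  refine Finset.prod_subset (Finset.subset_univ _) fun s _ hs => ?_
  rw [hα.2.1 s hs, ENNReal.rpow_zero]
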